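/- Let $R$ be a commutative ring, torsion free as an abelian group, and let $\mathfrak g$ be a Lie $R$-algebra that is torsion free as an $R$-module. Throughout, $R$ and all modules carry the trivial norm, so a sequence tends to $0$ iff it is eventually $0$. For a submodule $N$ of a module $M$, its *$R$-saturation* is the set of $x\in M$ with $rx\in N$ for some non-zero-divisor $r\in R$, and $M$ is *torsion free* if no non-zero-divisor of $R$ kills a nonzero element of $M$ (if $R$ is a domain: for some, resp. no, nonzero $r$). **Formal distributions.** For an $R$-module $M$ write $a(z)=\sum_{n\in\mathbf Z}a_{(n)}z^{-n-1}\in M[[z^{\pm1}]]$, $\partial_z^{(m)}=\frac1{m!}\partial_z^m$, and let $\mathrm{Res}_z$ be the coefficient of $z^{-1}$. For a Lie algebra $L$, distributions $a(z),b(z)\in L[[z^{\pm1}]]$ are *mutually local* if $(z-w)^N[a(z),b(w)]=0$ for all large $N$, and for $n\ge0$ their $n$-th product is $a(w)_{(n)}b(w)=\mathrm{Res}_z\big((z-w)^n[a(z),b(w)]\big)$. For an $R$-module $V$, the module of *fields* $\mathrm{End}(V)\langle\langle z\rangle\rangle$ consists of the $a(z)\in\mathrm{End}_R(V)[[z^{\pm1}]]$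 with $a(z)v\in V((z))$ for all $v\in V$ (i.e. $a_{(n)}v=0$ for $n\gg0$). For $m\ge0$ and fields $a,b$ put $a(z)_{(-m-1)}b(z)={:}(\partial_z^{(m)}a(z))\,b(z){:}$, where ${:}a(z)b(z){:}=a(z)_+b(z)+b(z)a(z)_-$, $a(z)_+=\sum_{n\le-1}a_{(n)}z^{-n-1}$ and $a(z)_-=\sum_{n\ge0}a_{(n)}z^{-n-1}$. The submodule of fields *generated* by a set $\mathcal S$ of fields is the smallest $R$-submodule of $\mathrm{End}(V)\langle\langle z\rangle\rangle$ that contains $\mathcal S\cup\{I_V\}$ and is preserved by all $n$-th products, $n\in\mathbf Z$. **Vertex $R$-algebras.** A *vertex $R$-algebra* structure on an $R$-module $V$, where $V$ is torsion free as an $R$-module and as an abelian group, consists of $|0\rangle\in V$, $T\in\mathrm{End}_R(V)$ with $T|0\rangle=0$, and an $R$-submodule $\mathrm{Fld}(V)\subset\mathrm{End}(V)\langle\langle z\rangle\rangle$ containing $I_V$, such that: (V.1) $\varphi(z)|0\rangle\in V[[z]]$ for all $\varphi\in\mathrm{Fld}(V)$; (V.2) $[T,\varphi(z)]=\partial_z\varphi(z)$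 for all $\varphi\in\mathrm{Fld}(V)$; (V.3) all fields in $\mathrm{Fld}(V)$ are mutually local (also with themselves); (V.4) $\mathrm{Fld}(V)$ is preserved by all $n$-th products, $n\in\mathbf Z$; (V.5) the $R$-saturation of $\{\varphi_{(-1)}|0\rangle:\varphi\in\mathrm{Fld}(V)\}$ is $V$. **Data.** Let $T$ be an $R$-linear derivation of $\mathfrak g$, acting coefficientwise on $\mathfrak g[[z^{\pm1}]]$, and let $\mathcal F=\{a^j(z)\}_{j\in J}\subset\mathfrak g[[z^{\pm1}]]$ be a family of formal distributions such that $a^i(z)$ and $a^j(z)$ are mutually local for all $i,j\in J$ (including $i=j$). Let $\mathcal F_T$ be the smallest $R$-submodule of $\mathfrak g[[z^{\pm1}]]$ that contains $\mathcal F$ and is invariant under $T$. Suppose that - (L.1) the $R$-saturation of the $R$-submodule of $\mathfrak g$ generated by all $a^j_{(n)}$, $j\in J$, $n\in\mathbf Z$, is $\mathfrak g$; - (L.2) $T(a^j(z))=\partial_za^j(z)$ for all $j\in J$; - (L.3) for all $n\ge0$ and $i,j\in J$, the $n$-th product $a^i(z)_{(n)}a^j(z)$ lies in $\mathcal F_T$.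 Let $\mathfrak g_-$ be the $R$-submodule of $\mathfrak g$ generated by all $a^j_{(n)}$ with $j\in J$, $n\ge0$, let $\mathbf a$ be the $R$-saturation of the left ideal $U(\mathfrak g)\mathfrak g_-$ of the universal enveloping $R$-algebra $U(\mathfrak g)$, and let $V=U(\mathfrak g)/\mathbf a$, on which $\mathfrak g$ acts by left multiplication. Let $\mathcal F|_V\subset\mathrm{End}_R(V)[[z^{\pm1}]]$ be the image of $\mathcal F$ under this action. **Claim.** All members of $\mathcal F|_V$ are fields, i.e. $\mathcal F|_V\subset\mathrm{End}(V)\langle\langle z\rangle\rangle$, and there is a vertex $R$-algebra structure on $V$ in which the vacuum $|0\rangle$ is the image of $1$, the translation operator is the endomorphism of $V$ induced by the derivation of $U(\mathfrak g)$ extending $T$ (so this derivation preserves $\mathbf a$), and $\mathrm{Fld}(V)$ is the $R$-submodule of $\mathrm{End}(V)\langle\langle z\rangle\rangle$ generated by $\mathcal F|_V$. -/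

import Mathlib

open Filter

noncomputable section

namespace LieVertex

-- An associative ring is a Lie ring under the commutator.
attribute [local instance 100] LieRing.ofAssociativeRing

/-! ### Formal distributions

All modules carry the trivial norm: a sequence tends to `0` iff it is eventually `0`, every
submodule is closed, and a submodule is dense iff it is everything. -/

/-- Formal distributions `a(z) ∈ M[[z^{±1}]]`; the value at `n` is the coefficient
`a_(n)` of `z^{-n-1}`, i.e. `a(z) = ∑ a_(n) z^{-n-1}`. -/
abbrev Dist (M : Type*) := ℤ → M

/-- Formal distributions `f(z,w) ∈ M[[z^{±1}, w^{±1}]]`; the value at `m n` is the coefficient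
of `z^{-m-1} w^{-n-1}`. -/
abbrev Dist₂ (M : Type*) := ℤ → ℤ → M

section Distributions

variable {M : Type*} [AddCommGroup M]

/-- Multiplication of `f(z,w)` by `z - w`. -/
def mulSub (f : Dist₂ M) : Dist₂ M := fun m n => f (m + 1) n - f m (n + 1)

/-- The residue `Res_z f(z,w)`, i.e. the coefficient of `z^{-1}`, as a distribution in `w`. -/
def resZ (f : Dist₂ M) : Dist M := fun n => f 0 n

/-- The derivative `∂_z a(z)`. -/
def derivZ (a : Dist M) : Dist M := fun n => (-n) • a (n - 1)

/-- The divided power derivative `∂_z^{(m)} = ∂_z^m / m!`, which sends `v z^k` to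
`(k choose m) v z^{k-m}`. -/
def hasseZ (m : ℕ) (a : Dist M) : Dist M := fun n => Ring.choose ((m : ℤ) - n - 1) m • a (n - m)

end Distributions

section Lie

variable {L : Type*} [LieRing L]

/-- The two-variable distribution `[a(z), b(w)]`. -/
def bracket₂ (a b : Dist L) : Dist₂ L := fun m n => ⁅a m, b n⁆

/-- Mutual locality: `(z - w)^N [a(z), b(w)] → 0` as `N → ∞` (for the trivial norm). -/
def MutuallyLocal (a b : Dist L) : Prop := ∀ᶠ N : ℕ in atTop, mulSub^[N] (bracket₂ a b) = 0

/-- The `n`-th product, `n ≥ 0`, of Lie algebra valued distributions: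
`a(w)_(n) b(w) = Res_z ((z - w)^n [a(z), b(w)])`. -/
def natProd (n : ℕ) (a b : Dist L) : Dist L := resZ (mulSub^[n] (bracket₂ a b))

end Lie

/-! ### Saturation -/

/-- The `R`-saturation of an `A`-submodule `N` (where `A` is an `R`-algebra): the elements `x` with
`r x ∈ N` for some non-zero-divisor `r` of `R` (for a domain `R`: for some nonzero `r`). -/
def saturation (R : Type*) {A M : Type*} [CommRing R] [Ring A] [Algebra R A] [AddCommGroup M]
    [Module R M] [Module A M] [IsScalarTower R A M] (N : Submodule A M) : Submodule A M where
  carrier := {x | ∃ r ∈ nonZeroDivisors R, r • x ∈ N}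
  zero_mem' := ⟨1, one_mem _, by simp⟩
  add_mem' := by
    rintro x y ⟨r, hr, hx⟩ ⟨s, hs, hy⟩
    refine ⟨s * r, mul_mem hs hr, ?_⟩
    rw [smul_add]
    refine N.add_mem ?_ ?_
    · rw [mul_smul]
      exact N.smul_of_tower_mem s hx
    · rw [mul_comm, mul_smul]
      exact N.smul_of_tower_mem r hy
  smul_mem' := by
    rintro a x ⟨r, hr, hx⟩
    refine ⟨r, hr, ?_⟩
    rw [← smul_algebra_smul_comm]
    exact N.smul_mem a hx

/-! ### Fields -/

section Fields

variable (R V : Type*) [CommRing R] [AddCommGroup V] [Module R V]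

/-- The `R`-module `End(V)⟨⟨z⟩⟩` of `End(V)`-valued quantum fields: the distributions `a(z)` such
that, for every `v`, `a_(n) v → 0` as `n → +∞`, i.e. `a(z) v ∈ V((z))`. -/
def Fields : Submodule R (Dist (Module.End R V)) where
  carrier := {a | ∀ v : V, ∀ᶠ n : ℤ in atTop, a n v = 0}
  zero_mem' := fun v => by simp
  add_mem' := by
    intro a b ha hb v
    filter_upwards [ha v, hb v] with n h1 h2
    simp [h1, h2]
  smul_mem' := by
    intro r a ha v
    filter_upwards [ha v] with n h1
    simp [h1]

variable {R V}

theorem mem_fields {a : Dist (Module.End R V)} :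
    a ∈ Fields R V ↔ ∀ v : V, ∀ᶠ n : ℤ in atTop, a n v = 0 := Iff.rfl

/-- A distribution is a field iff it comes from a linear map `V → V((z))`. -/
theorem mem_fields_iff_vertexOperator {a : Dist (Module.End R V)} :
    a ∈ Fields R V ↔ ∃ A : VertexOperator R V, VertexOperator.ncoeff A = a := by
  constructor
  · intro h
    refine ⟨VertexOperator.of_coeff (fun n => a (-n - 1)) ?_, ?_⟩
    · intro v
      obtain ⟨N, hN⟩ := eventually_atTop.1 (h v)
      refine ⟨-N - 1, fun k hk => ?_⟩
      by_contra hlt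
      exact hk (hN _ (by omega))
    · funext n
      rw [VertexOperator.ncoeff_of_coeff]
      congr 1
      ring
  · rintro ⟨A, rfl⟩ v
    filter_upwards [eventually_gt_atTop
      (-HahnSeries.order ((HahnModule.of R).symm (A v)) - 1)] with n hn
    exact VertexOperator.ncoeff_eq_zero_of_lt_order A n v (by omega)

theorem fields_finite_support (a : Fields R V) (v : V) (g : ℤ → ℕ → ℤ) (p : ℤ)
    (hg : Tendsto (g p) atTop atTop) :
    {k : ℕ | (a : Dist (Module.End R V)) (g p k) v ≠ 0}.Finite := by
  have h := hg.eventually (a.2 v)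
  rw [← Nat.cofinite_eq_atTop] at h
  exact h

/-- Divided power derivatives of a field. -/
def hasseField (m : ℕ) (a : Fields R V) : Fields R V :=
  ⟨hasseZ m (a : Dist (Module.End R V)), by
    intro v
    have h := (tendsto_atTop_add_const_right atTop (-(m : ℤ)) tendsto_id).eventually (a.2 v)
    filter_upwards [h] with n hn
    have hn' : (a : Dist (Module.End R V)) (n - m) v = 0 := hn
    simp [hasseZ, hn']⟩

theorem tendsto_add_nat (p : ℤ) : Tendsto (fun k : ℕ => p + (k : ℤ)) atTop atTop :=
  tendsto_atTop_add_const_left atTop p tendsto_natCast_atTop_atTop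

theorem normal_finite_left (a b : Fields R V) (p : ℤ) (v : V) :
    (Function.support fun k : ℕ => (a : Dist (Module.End R V)) (-(k : ℤ) - 1)
      ((b : Dist (Module.End R V)) (p + k) v)).Finite := by
  refine (fields_finite_support b v (fun p k => p + (k : ℤ)) p (tendsto_add_nat p)).subset ?_
  intro k hk h0
  apply hk
  simp only at h0 ⊢
  rw [h0, map_zero]

theorem normal_finite_right (a b : Fields R V) (p : ℤ) (v : V) :
    (Function.support fun k : ℕ => (b : Dist (Module.End R V)) (p - 1 - k)
      ((a : Dist (Module.End R V)) (k : ℤ) v)).Finite := by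
  refine (fields_finite_support a v (fun _ k => (k : ℤ)) p
    tendsto_natCast_atTop_atTop).subset ?_
  intro k hk h0
  apply hk
  simp only at h0 ⊢
  rw [h0, map_zero]

/-- The coefficient at `z^{-p-1}` of `:a(z) b(z): = a(z)_+ b(z) + b(z) a(z)_-`, that is
`∑_{m ≤ -1} a_(m) b_(p-1-m) + ∑_{m ≥ 0} b_(p-1-m) a_(m)`; both sums are finite on each vector.
In the first sum `m = -k-1`, in the second `m = k`. -/
def normalCoeff (a b : Fields R V) (p : ℤ) : Module.End R V where
  toFun v := (∑ᶠ k : ℕ, (a : Dist (Module.End R V)) (-(k : ℤ) - 1)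
      ((b : Dist (Module.End R V)) (p + k) v)) +
    ∑ᶠ k : ℕ, (b : Dist (Module.End R V)) (p - 1 - k) ((a : Dist (Module.End R V)) (k : ℤ) v)
  map_add' u v := by
    simp only [map_add]
    rw [finsum_add_distrib (normal_finite_left a b p u) (normal_finite_left a b p v),
      finsum_add_distrib (normal_finite_right a b p u) (normal_finite_right a b p v)]
    abel
  map_smul' r v := by
    simp only [map_smul, RingHom.id_apply, smul_add]
    rw [smul_finsum' r (normal_finite_left a b p v), smul_finsum' r (normal_finite_right a b p v)]

/-- The normally ordered product `:a(z) b(z):` of two fields. -/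
def normalProd (a b : Fields R V) : Fields R V :=
  ⟨fun p => normalCoeff a b p, by
    intro v
    obtain ⟨N, hN⟩ := eventually_atTop.1 (b.2 v)
    have hfin := fields_finite_support a v (fun _ k => (k : ℤ)) 0 tendsto_natCast_atTop_atTop
    have h2 : ∀ᶠ p : ℤ in atTop, ∀ k ∈ {k : ℕ | (a : Dist (Module.End R V)) (k : ℤ) v ≠ 0},
        (b : Dist (Module.End R V)) (p - 1 - k) ((a : Dist (Module.End R V)) (k : ℤ) v) = 0 := by
      rw [eventually_all_finite hfin]
      intro k _
      have h := (tendsto_atTop_add_const_right atTop (-1 - (k : ℤ)) tendsto_id).eventually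
        (b.2 ((a : Dist (Module.End R V)) (k : ℤ) v))
      filter_upwards [h] with p hp
      have he : p - 1 - (k : ℤ) = id p + (-1 - (k : ℤ)) := by simp only [id]; ring
      rw [he]
      exact hp
    filter_upwards [h2, eventually_ge_atTop N] with p hp hpN
    have e1 : ∀ k : ℕ, (a : Dist (Module.End R V)) (-(k : ℤ) - 1)
        ((b : Dist (Module.End R V)) (p + k) v) = 0 := by
      intro k
      rw [hN (p + k) (by omega), map_zero]
    have e2 : ∀ k : ℕ, (b : Dist (Module.End R V)) (p - 1 - k)
        ((a : Dist (Module.End R V)) (k : ℤ) v) = 0 := by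
      intro k
      by_cases hk : (a : Dist (Module.End R V)) (k : ℤ) v = 0
      · rw [hk, map_zero]
      · exact hp k hk
    simp [normalCoeff, e1, e2]⟩

/-- The `n`-th product, `n ≥ 0`, of two fields. -/
def natProdField (n : ℕ) (a b : Fields R V) : Fields R V :=
  ⟨natProd n (a : Dist (Module.End R V)) (b : Dist (Module.End R V)), by
    have key : ∀ (n : ℕ) (m : ℤ) (v : V), ∀ᶠ q : ℤ in atTop,
        (mulSub^[n] (bracket₂ (a : Dist (Module.End R V)) (b : Dist (Module.End R V)))) m q v
          = 0 := by
      intro n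
      induction n with
      | zero =>
        intro m v
        filter_upwards [b.2 v, b.2 ((a : Dist (Module.End R V)) m v)] with q h1 h2
        simp [bracket₂, LieRing.of_associative_ring_bracket, h1, h2]
      | succ n ih =>
        intro m v
        have h := (tendsto_atTop_add_const_right atTop (1 : ℤ) tendsto_id).eventually (ih m v)
        filter_upwards [ih (m + 1) v, h] with q h1 h2
        rw [Function.iterate_succ_apply', mulSub, LinearMap.sub_apply, h1]
        have h2' := h2
        simp only [id] at h2'
        rw [h2', sub_zero]
    exact fun v => key n 0 v⟩

/-- The `n`-th product of two fields for every `n ∈ ℤ`: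
`a(z)_(-m-1) b(z) = :(∂_z^{(m)} a(z)) b(z):` for `m ≥ 0`. -/
def nthProd : ℤ → Fields R V → Fields R V → Fields R V
  | Int.ofNat n, a, b => natProdField n a b
  | Int.negSucc m, a, b => normalProd (hasseField m a) b

variable (R V) in
/-- The identity operator `I_V`, viewed as a constant field. -/
def idField : Fields R V :=
  ⟨Pi.single (-1) 1, by
    intro v
    filter_upwards [eventually_ge_atTop (0 : ℤ)] with n hn
    rw [Pi.single_eq_of_ne (by omega)]
    rfl⟩

/-- The `R`-submodule of fields generated by `F`: the smallest one that contains `F` and `I_V` and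
is preserved by all `n`-th products, `n ∈ ℤ`. -/
def generatedFields (F : Set (Fields R V)) : Submodule R (Fields R V) :=
  sInf {S | F ⊆ S ∧ idField R V ∈ S ∧
    ∀ (n : ℤ) (a b : Fields R V), a ∈ S → b ∈ S → nthProd n a b ∈ S}

/-- The field-state homomorphism `φ(z) ↦ φ_(-1) vac`. -/
def fieldState (vac : V) : Fields R V →ₗ[R] V where
  toFun φ := (φ : Dist (Module.End R V)) (-1) vac
  map_add' _ _ := rfl
  map_smul' _ _ := rfl

variable (R V) in
/-- The structure of a vertex `R`-algebra on `V`, where `R` and `V` carry the trivial norm. -/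
structure VertexAlgebra where
  /-- `V` is a torsion free `R`-module. -/
  torsionFree : Module.IsTorsionFree R V
  /-- `V` is torsion free as an abelian group. -/
  addTorsionFree : IsAddTorsionFree V
  /-- The vacuum vector. -/
  vacuum : V
  /-- The translation operator. -/
  T : Module.End R V
  T_vacuum : T vacuum = 0
  /-- The space of fields. -/
  Fld : Submodule R (Fields R V)
  id_mem : idField R V ∈ Fld
  /-- `φ(z)|0⟩ ∈ V[[z]]`. -/
  vacuum_axiom : ∀ φ ∈ Fld, ∀ n : ℤ, 0 ≤ n → (φ : Dist (Module.End R V)) n vacuum = 0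
  /-- `[T, φ(z)] = ∂_z φ(z)`. -/
  translation : ∀ φ ∈ Fld, ∀ n : ℤ,
    T * (φ : Dist (Module.End R V)) n - (φ : Dist (Module.End R V)) n * T =
      derivZ (φ : Dist (Module.End R V)) n
  locality : ∀ φ ∈ Fld, ∀ ψ ∈ Fld,
    MutuallyLocal (φ : Dist (Module.End R V)) (ψ : Dist (Module.End R V))
  nthProd_mem : ∀ (n : ℤ), ∀ φ ∈ Fld, ∀ ψ ∈ Fld, nthProd n φ ψ ∈ Fld
  /-- The `R`-saturation of the image of the field-state homomorphism is dense, i.e. all of `V`. -/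
  completeness : saturation R (Fld.map (fieldState vacuum)) = ⊤

end Fields

/-! ### The module associated with a Lie algebra and a family of distributions -/

section LieAlgebra

variable (R : Type*) {g : Type*} [CommRing R] [LieRing g] [LieAlgebra R g] {J : Type*}

/-- The `R`-submodule of `g` generated by all the coefficients `a^j_(n)`, `n ∈ ℤ`. -/
def coeffSpan (F : J → Dist g) : Submodule R g :=
  Submodule.span R {x | ∃ (j : J) (n : ℤ), x = F j n}

/-- `g_-`, the `R`-submodule of `g` generated by the coefficients `a^j_(n)` with `n ≥ 0`. -/
def annihilation (F : J → Dist g) : Submodule R g :=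
  Submodule.span R {x | ∃ (j : J) (n : ℤ), 0 ≤ n ∧ x = F j n}

variable {R} in
/-- `F_T`: the smallest `R`-submodule of `g[[z^{±1}]]` that contains `F` and is invariant under
the (coefficientwise) action of the derivation `T`. -/
def translationSpan (T : LieDerivation R g g) (F : J → Dist g) : Submodule R (Dist g) :=
  sInf {S | Set.range F ⊆ S ∧ ∀ a ∈ S, (fun n => T (a n)) ∈ S}

/-- The left ideal `U(g) g_-` of the universal enveloping algebra `U(g)`. -/
def annihilationIdeal (F : J → Dist g) :
    Submodule (UniversalEnvelopingAlgebra R g) (UniversalEnvelopingAlgebra R g) :=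
  Submodule.span (UniversalEnvelopingAlgebra R g)
    (UniversalEnvelopingAlgebra.ι R '' (annihilation R F : Set g))

/-- `V = U(g) / 𝐚`, where `𝐚` is the `R`-saturation of the left ideal `U(g) g_-`. -/
abbrev StateSpace (F : J → Dist g) : Type _ :=
  UniversalEnvelopingAlgebra R g ⧸ saturation R (annihilationIdeal R F)

/-- The quotient map `U(g) → V`. -/
def toState (F : J → Dist g) :
    UniversalEnvelopingAlgebra R g →ₗ[UniversalEnvelopingAlgebra R g] StateSpace R F :=
  (saturation R (annihilationIdeal R F)).mkQ

/-- The image `F|_V` of a `g`-valued distribution under the action of `g` on `V` by left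
multiplication. -/
def actionDist (F : J → Dist g) (a : Dist g) : Dist (Module.End R (StateSpace R F)) := fun n =>
  Algebra.lsmul R R (StateSpace R F) (UniversalEnvelopingAlgebra.ι R (a n))

variable {R}

/-- The Lie homomorphism `x ↦ x + ε T(x)` from `g` to the dual numbers over `U(g)`. -/
def envAux (T : LieDerivation R g g) : g →ₗ⁅R⁆ DualNumber (UniversalEnvelopingAlgebra R g) where
  toFun x := TrivSqZeroExt.inl (UniversalEnvelopingAlgebra.ι R x) +
    TrivSqZeroExt.inr (UniversalEnvelopingAlgebra.ι R (T x))
  map_add' x y := by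
    simp only [map_add, TrivSqZeroExt.inl_add, TrivSqZeroExt.inr_add]
    abel
  map_smul' r x := by
    simp only [map_smul, TrivSqZeroExt.inl_smul, TrivSqZeroExt.inr_smul, smul_add,
      RingHom.id_apply]
  map_lie' := by
    intro x y
    ext
    · simp [LieRing.of_associative_ring_bracket]
    · simp only [TrivSqZeroExt.snd_add, TrivSqZeroExt.snd_inl, TrivSqZeroExt.snd_inr,
        LieRing.of_associative_ring_bracket, TrivSqZeroExt.snd_sub, TrivSqZeroExt.snd_mul,
        TrivSqZeroExt.fst_add, TrivSqZeroExt.fst_inl, TrivSqZeroExt.fst_inr, smul_eq_mul,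
        MulOpposite.smul_eq_mul_unop, MulOpposite.unop_op, LieDerivation.apply_lie_eq_sub,
        map_sub, LieHom.map_lie, zero_add, add_zero]
      abel

/-- The unique `R`-linear derivation of the algebra `U(g)` that extends `T`. -/
def envDerivation (T : LieDerivation R g g) :
    UniversalEnvelopingAlgebra R g →ₗ[R] UniversalEnvelopingAlgebra R g :=
  (TrivSqZeroExt.sndHom (UniversalEnvelopingAlgebra R g)
    (UniversalEnvelopingAlgebra R g)).restrictScalars R ∘ₗ
    (UniversalEnvelopingAlgebra.lift R (envAux T)).toLinearMap

theorem envDerivation_ι (T : LieDerivation R g g) (x : g) :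
    envDerivation T (UniversalEnvelopingAlgebra.ι R x) = UniversalEnvelopingAlgebra.ι R (T x) := by
  simp [envDerivation, envAux]

theorem fst_lift_envAux (T : LieDerivation R g g) (x : UniversalEnvelopingAlgebra R g) :
    (UniversalEnvelopingAlgebra.lift R (envAux T) x).fst = x := by
  have h : (TrivSqZeroExt.fstHom R (UniversalEnvelopingAlgebra R g)
      (UniversalEnvelopingAlgebra R g)).comp (UniversalEnvelopingAlgebra.lift R (envAux T)) =
      AlgHom.id R _ := by
    apply UniversalEnvelopingAlgebra.hom_ext
    ext y
    simp [envAux]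
  exact DFunLike.congr_fun h x

theorem envDerivation_mul (T : LieDerivation R g g) (x y : UniversalEnvelopingAlgebra R g) :
    envDerivation T (x * y) = x * envDerivation T y + envDerivation T x * y := by
  simp [envDerivation, fst_lift_envAux]

end LieAlgebra

end LieVertex

end

noncomputable section

namespace LieVertex

attribute [local instance 100] LieRing.ofAssociativeRing

/-! ### Multiplication by `z - w` -/

section MulSub

variable {M : Type*} [AddCommGroup M]

-- Three closure properties, each propagated from the generators to everything they generate, give
-- the vertex algebra axioms on `V`. Locality passes to products by Dong's lemma. The negative
-- products are brought under the same argument as the nonnegative ones by writing `:a(w) b(w):` as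
-- the residue of a kernel, "(z - w)^{-1} [a(z), b(w)]", that one factor `z - w` turns back into the
-- bracket (`mulSub_normalKernel`). Translation covariance is a Leibniz rule. On the vacuum, `(a_(n)
-- b)_(-1) vac = a_(n) (b_(-1) vac)` (`Creates.nthProd_neg_one`), so the states of generated fields
-- are stable under all `a^j_(n)`.
--
-- Divided powers are handled by dividing `∂ ∂^{(m)} = (m + 1) ∂^{(m+1)}` by `m + 1`. This is where
-- torsion freeness of `V` as an abelian group enters.
--
-- Everything about the size of `V` rests on `eq_top_of_stable`: a saturated submodule containing
-- the vacuum and stable under all `a^j_(n)` is `V`. It is used twice: for completeness, and to show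
-- that the `a^j(z)` act by fields. In the second case the vectors `v` with all `a^j(z) v ∈ V((z))`
-- must be shown to be stable. By locality and (L.3), finitely many products, each controlled on
-- `v`, determine `[a^i_(n), a^j_(m)] v`, which therefore vanishes for large `n`
-- (`eq_zero_of_mulSub_iterate_eq_zero`).

theorem mulSub_iterate_succ (k : ℕ) (f : Dist₂ M) (m n : ℤ) :
    mulSub^[k + 1] f m n = mulSub^[k] f (m + 1) n - mulSub^[k] f m (n + 1) := by
  rw [Function.iterate_succ_apply']
  rfl

theorem mulSub_iterate_zero (k : ℕ) : mulSub^[k] (0 : Dist₂ M) = 0 := by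
  induction k with
  | zero => rfl
  | succ k ih =>
    funext m n
    rw [mulSub_iterate_succ, ih]
    simp

theorem mulSub_iterate_eq_zero_of_le {f : Dist₂ M} {N K : ℕ} (h : mulSub^[N] f = 0)
    (hK : N ≤ K) : mulSub^[K] f = 0 := by
  obtain ⟨d, rfl⟩ := Nat.exists_eq_add_of_le hK
  rw [add_comm, Function.iterate_add_apply, h, mulSub_iterate_zero]

theorem mulSub_iterate_add (k : ℕ) (f g : Dist₂ M) :
    mulSub^[k] (f + g) = mulSub^[k] f + mulSub^[k] g := by
  induction k with
  | zero => rfl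
  | succ k ih =>
    funext m n
    simp only [Pi.add_apply, mulSub_iterate_succ, ih]
    abel

theorem mulSub_iterate_map {M' : Type*} [AddCommGroup M'] (φ : M →+ M') (k : ℕ) (f : Dist₂ M)
    (m n : ℤ) : mulSub^[k] (fun m n => φ (f m n)) m n = φ (mulSub^[k] f m n) := by
  induction k generalizing m n with
  | zero => rfl
  | succ k ih => rw [mulSub_iterate_succ, mulSub_iterate_succ, ih, ih, map_sub]

/-- `(z - w)^{k+1} ∂_z f = ∂_z ((z - w)^{k+1} f) - (k + 1) (z - w)^k f`. -/
theorem mulSub_iterate_derivZ (k : ℕ) (f : Dist₂ M) (m n : ℤ) :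
    mulSub^[k + 1] (fun m n => (-m) • f (m - 1) n) m n =
      (-m) • mulSub^[k + 1] f (m - 1) n - ((k : ℤ) + 1) • mulSub^[k] f m n := by
  induction k generalizing m n with
  | zero =>
    simp only [mulSub_iterate_succ, Function.iterate_zero, id, sub_add_cancel, add_sub_cancel_right,
      Nat.cast_zero, smul_sub]
    module
  | succ k ih =>
    rw [mulSub_iterate_succ, ih, ih, mulSub_iterate_succ (k + 1), mulSub_iterate_succ k f m n,
      add_sub_cancel_right, sub_add_cancel]
    have h1 : mulSub^[k + 1] f m n = mulSub^[k] f (m + 1) n - mulSub^[k] f m (n + 1) :=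
      mulSub_iterate_succ k f m n
    rw [h1]
    push_cast
    module

end MulSub

/-! ### Mutual locality -/

section Locality

variable {L : Type*} [LieRing L]

theorem mutuallyLocal_iff {a b : Dist L} :
    MutuallyLocal a b ↔ ∃ N : ℕ, mulSub^[N] (bracket₂ a b) = 0 := by
  refine ⟨fun h => h.exists, fun ⟨N, hN⟩ => ?_⟩
  filter_upwards [eventually_ge_atTop N] with K hK
  exact mulSub_iterate_eq_zero_of_le hN hK

/-- Of the `k + 1` signs, one comes from antisymmetry of the bracket and `k` from exchanging the
variables in `(z - w)^k`. -/
theorem mulSub_iterate_bracket₂_swap (k : ℕ) (a b : Dist L) (m n : ℤ) :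
    mulSub^[k] (bracket₂ b a) m n = (-1 : ℤ) ^ (k + 1) • mulSub^[k] (bracket₂ a b) n m := by
  induction k generalizing m n with
  | zero => simp [bracket₂]
  | succ k ih =>
    rw [mulSub_iterate_succ, mulSub_iterate_succ, ih, ih, pow_succ _ (k + 1)]
    module

theorem MutuallyLocal.symm {a b : Dist L} (h : MutuallyLocal a b) : MutuallyLocal b a := by
  obtain ⟨N, hN⟩ := mutuallyLocal_iff.1 h
  refine mutuallyLocal_iff.2 ⟨N, ?_⟩
  funext m n
  rw [mulSub_iterate_bracket₂_swap, hN]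
  simp

theorem mutuallyLocal_zero_left (b : Dist L) : MutuallyLocal 0 b := by
  refine mutuallyLocal_iff.2 ⟨0, ?_⟩
  funext m n
  simp [bracket₂]

theorem MutuallyLocal.add_left {a a' b : Dist L} (h : MutuallyLocal a b)
    (h' : MutuallyLocal a' b) : MutuallyLocal (a + a') b := by
  filter_upwards [h, h'] with N hN hN'
  have e : bracket₂ (a + a') b = bracket₂ a b + bracket₂ a' b := by
    funext m n
    simp [bracket₂]
  rw [e, mulSub_iterate_add, hN, hN', add_zero]

theorem MutuallyLocal.smul_left {R : Type*} [CommRing R] [LieAlgebra R L] (r : R) {a b : Dist L}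
    (h : MutuallyLocal a b) : MutuallyLocal (r • a) b := by
  filter_upwards [h] with N hN
  funext m n
  have e : bracket₂ (r • a) b =
      fun m n => (DistribSMul.toAddMonoidHom L r) (bracket₂ a b m n) := by
    funext m n
    simp [bracket₂]
  rw [e, mulSub_iterate_map, hN]
  simp

theorem MutuallyLocal.map {L' : Type*} [LieRing L'] {a b : Dist L} (h : MutuallyLocal a b)
    (φ : L →+ L') (hφ : ∀ x y, φ ⁅x, y⁆ = ⁅φ x, φ y⁆) :
    MutuallyLocal (fun n => φ (a n)) (fun n => φ (b n)) := by
  filter_upwards [h] with N hN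
  have e : bracket₂ (fun n => φ (a n)) (fun n => φ (b n)) = fun m n => φ (bracket₂ a b m n) := by
    funext m n
    simp [bracket₂, hφ]
  funext m n
  rw [e, mulSub_iterate_map, hN]
  simp

/-- The product rule costs one power of `z - w`: differentiating `(z - w)^{N+1}` still leaves `(z -
w)^N`. -/
theorem MutuallyLocal.derivZ_left {a b : Dist L} (h : MutuallyLocal a b) :
    MutuallyLocal (derivZ a) b := by
  obtain ⟨N, hN⟩ := mutuallyLocal_iff.1 h
  refine mutuallyLocal_iff.2 ⟨N + 1, ?_⟩
  funext m n
  have e : bracket₂ (derivZ a) b = fun m n => (-m) • bracket₂ a b (m - 1) n := by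
    funext m n
    simp only [bracket₂, derivZ, zsmul_lie]
  rw [e, mulSub_iterate_derivZ, hN, mulSub_iterate_eq_zero_of_le hN (Nat.le_succ N)]
  simp

theorem MutuallyLocal.of_nsmul_left [IsAddTorsionFree L] {a b : Dist L} {k : ℕ} (hk : k ≠ 0)
    (h : MutuallyLocal (k • a) b) : MutuallyLocal a b := by
  filter_upwards [h] with N hN
  funext m n
  have e : bracket₂ (k • a) b = fun m n => (nsmulAddMonoidHom k) (bracket₂ a b m n) := by
    funext m n
    simp [bracket₂]
  have := congrFun (congrFun hN m) n
  rw [e, mulSub_iterate_map] at this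
  simpa [hk] using this

end Locality

/-! ### Divided power derivatives -/

section Hasse

variable {M : Type*} [AddCommGroup M]

theorem hasseZ_zero (a : Dist M) : hasseZ 0 a = a := by
  funext n
  simp [hasseZ]

/-- Passing from the `m`-th to the `(m+1)`-st falling factorial of `x` multiplies by `x - m`;
cancelling `m!` gives the identity for all integers `x`, including negative ones. -/
theorem sub_mul_choose (x : ℤ) (m : ℕ) :
    (x - m) * Ring.choose x m = (m + 1) * Ring.choose x (m + 1) := by
  have h1 := Ring.descPochhammer_eq_factorial_smul_choose x m
  have h2 := Ring.descPochhammer_eq_factorial_smul_choose x (m + 1)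
  rw [descPochhammer_succ_right, Polynomial.smeval_mul, h1] at h2
  have h3 : (Polynomial.X - (m : Polynomial ℤ)).smeval x = x - m := by
    rw [Polynomial.smeval_sub, Polynomial.smeval_X, Polynomial.smeval_natCast]
    simp
  rw [h3, Nat.factorial_succ] at h2
  have h4 : (m.factorial : ℤ) ≠ 0 := by exact_mod_cast m.factorial_ne_zero
  apply mul_left_cancel₀ h4
  simp only [nsmul_eq_mul, Nat.cast_mul] at h2
  push_cast at h2
  linear_combination h2

theorem derivZ_hasseZ (m : ℕ) (a : Dist M) :
    derivZ (hasseZ m a) = (m + 1) • hasseZ (m + 1) a := by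
  funext n
  have h := sub_mul_choose ((m : ℤ) - n) m
  simp only [derivZ, hasseZ, Pi.smul_apply]
  have e1 : (m : ℤ) - (n - 1) - 1 = m - n := by ring
  have e2 : ((m + 1 : ℕ) : ℤ) - n - 1 = m - n := by push_cast; ring
  have e3 : n - 1 - (m : ℤ) = n - ((m + 1 : ℕ) : ℤ) := by push_cast; ring
  rw [e1, e2, e3, smul_smul, ← natCast_zsmul _ (m + 1), smul_smul]
  congr 1
  push_cast
  linear_combination h

end Hasse

theorem MutuallyLocal.hasseZ_left {L : Type*} [LieRing L] [IsAddTorsionFree L] {a b : Dist L}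
    (h : MutuallyLocal a b) (m : ℕ) : MutuallyLocal (hasseZ m a) b := by
  induction m with
  | zero => rwa [hasseZ_zero]
  | succ m ih =>
    have := ih.derivZ_left
    rw [derivZ_hasseZ] at this
    exact this.of_nsmul_left m.succ_ne_zero

/-! ### Dong's lemma -/

section Dong

/-- Formal distributions in three variables `z, w, u`. -/
abbrev Dist₃ (M : Type*) := ℤ → ℤ → ℤ → M

variable (M : Type*) [AddCommGroup M]

/-- Multiplication by `z - w`. -/
def mulSub₁₂ : Module.End ℤ (Dist₃ M) where
  toFun f m p q := f (m + 1) p q - f m (p + 1) q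
  map_add' f g := by
    funext m p q
    simp only [Pi.add_apply]
    abel
  map_smul' r f := by
    funext m p q
    simp only [Pi.smul_apply, RingHom.id_apply, smul_sub]

/-- Multiplication by `z - u`. -/
def mulSub₁₃ : Module.End ℤ (Dist₃ M) where
  toFun f m p q := f (m + 1) p q - f m p (q + 1)
  map_add' f g := by
    funext m p q
    simp only [Pi.add_apply]
    abel
  map_smul' r f := by
    funext m p q
    simp only [Pi.smul_apply, RingHom.id_apply, smul_sub]

/-- Multiplication by `w - u`. -/
def mulSub₂₃ : Module.End ℤ (Dist₃ M) where
  toFun f m p q := f m (p + 1) q - f m p (q + 1)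
  map_add' f g := by
    funext m p q
    simp only [Pi.add_apply]
    abel
  map_smul' r f := by
    funext m p q
    simp only [Pi.smul_apply, RingHom.id_apply, smul_sub]

variable {M}

theorem mulSub₁₂_apply (f : Dist₃ M) (m p q : ℤ) :
    mulSub₁₂ M f m p q = f (m + 1) p q - f m (p + 1) q := rfl

theorem mulSub₁₃_apply (f : Dist₃ M) (m p q : ℤ) :
    mulSub₁₃ M f m p q = f (m + 1) p q - f m p (q + 1) := rfl

theorem mulSub₂₃_apply (f : Dist₃ M) (m p q : ℤ) :
    mulSub₂₃ M f m p q = f m (p + 1) q - f m p (q + 1) := rfl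

variable (M)

theorem mulSub₂₃_eq : mulSub₂₃ M = mulSub₁₃ M + -mulSub₁₂ M := by
  ext f m p q
  simp only [LinearMap.add_apply, LinearMap.neg_apply, Pi.add_apply, Pi.neg_apply, mulSub₁₂_apply,
    mulSub₁₃_apply, mulSub₂₃_apply]
  abel

theorem commute_mulSub₁₂_mulSub₁₃ : Commute (mulSub₁₂ M) (mulSub₁₃ M) := by
  ext f m p q
  simp only [Module.End.mul_apply, mulSub₁₂_apply, mulSub₁₃_apply]
  abel

theorem commute_mulSub₁₂_mulSub₂₃ : Commute (mulSub₁₂ M) (mulSub₂₃ M) := by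
  rw [mulSub₂₃_eq]
  exact (commute_mulSub₁₂_mulSub₁₃ M).add_right (Commute.refl _).neg_right

theorem commute_mulSub₁₃_mulSub₂₃ : Commute (mulSub₁₃ M) (mulSub₂₃ M) := by
  rw [mulSub₂₃_eq]
  exact (Commute.refl _).add_right (commute_mulSub₁₂_mulSub₁₃ M).symm.neg_right

variable {M}

theorem mulSub₁₂_pow_apply (k : ℕ) (f : Dist₃ M) (m p q : ℤ) :
    (mulSub₁₂ M ^ k) f m p q = mulSub^[k] (fun m p => f m p q) m p := by
  induction k generalizing m p with
  | zero => rfl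
  | succ k ih =>
    rw [pow_succ', Module.End.mul_apply, mulSub₁₂_apply, ih, ih, mulSub_iterate_succ]

theorem mulSub₁₃_pow_apply (k : ℕ) (f : Dist₃ M) (m p q : ℤ) :
    (mulSub₁₃ M ^ k) f m p q = mulSub^[k] (fun m q => f m p q) m q := by
  induction k generalizing m q with
  | zero => rfl
  | succ k ih =>
    rw [pow_succ', Module.End.mul_apply, mulSub₁₃_apply, ih, ih, mulSub_iterate_succ]

theorem mulSub₂₃_pow_apply (k : ℕ) (f : Dist₃ M) (m p q : ℤ) :
    (mulSub₂₃ M ^ k) f m p q = mulSub^[k] (f m) p q := by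
  induction k generalizing p q with
  | zero => rfl
  | succ k ih =>
    rw [pow_succ', Module.End.mul_apply, mulSub₂₃_apply, ih, ih, mulSub_iterate_succ]

/-- The algebraic core of Dong's lemma. Since `w - u = (z - u) - (z - w)`, each term of the binomial
expansion of `(w - u)^{N+K}` contains either `(z - u)^N` or `(z - w)^K`. The former kills `f`
together with the remaining `(w - u)^N`, the latter kills it alone. -/
theorem mulSub₂₃_pow_eq_zero {f : Dist₃ M} {K N : ℕ} (h₁₂ : (mulSub₁₂ M ^ K) f = 0)
    (h : (mulSub₁₃ M ^ N) ((mulSub₂₃ M ^ N) f) = 0) : (mulSub₂₃ M ^ (N + K + N)) f = 0 := by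
  have hc : Commute (mulSub₁₃ M) (-mulSub₁₂ M) := (commute_mulSub₁₂_mulSub₁₃ M).symm.neg_right
  rw [pow_add, Module.End.mul_apply]
  -- Only the outer power is expanded; the inner `(w - u)^N` is kept for `h`.
  nth_rw 1 [mulSub₂₃_eq]
  rw [hc.add_pow', LinearMap.sum_apply]
  refine Finset.sum_eq_zero fun ij hij => ?_
  rw [LinearMap.smul_apply]
  have hij' : ij.1 + ij.2 = N + K := Finset.HasAntidiagonal.mem_antidiagonal.1 hij
  suffices hz : (mulSub₁₃ M ^ ij.1 * (-mulSub₁₂ M) ^ ij.2) ((mulSub₂₃ M ^ N) f) = 0 by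
    rw [hz, smul_zero]
  by_cases hi : N ≤ ij.1
  · rw [(hc.pow_pow _ _).eq]
    obtain ⟨d, hd⟩ := Nat.exists_eq_add_of_le hi
    rw [hd, add_comm, pow_add, ← mul_assoc, Module.End.mul_apply _ (mulSub₁₃ M ^ N), h, map_zero]
  · obtain ⟨d, hd⟩ := Nat.exists_eq_add_of_le (show K ≤ ij.2 by omega)
    rw [hd, add_comm, pow_add, neg_pow _ K, ← mul_assoc, ← mul_assoc, Module.End.mul_apply,
      ← Module.End.mul_apply (mulSub₁₂ M ^ K),
      ((commute_mulSub₁₂_mulSub₂₃ M).pow_pow K N).eq,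
      Module.End.mul_apply (mulSub₂₃ M ^ N), h₁₂, map_zero, map_zero]

variable {L : Type*} [LieRing L]

/-- The three-variable distribution `[X(z,w), c(u)]`. -/
def bracket₃ (X : Dist₂ L) (c : Dist L) : Dist₃ L := fun m p q => ⁅X m p, c q⁆

theorem mulSub₁₂_pow_bracket₃ (k : ℕ) (X : Dist₂ L) (c : Dist L) :
    (mulSub₁₂ L ^ k) (bracket₃ X c) = bracket₃ (mulSub^[k] X) c := by
  funext m p q
  rw [mulSub₁₂_pow_apply]
  exact mulSub_iterate_map (AddMonoidHom.mk' (fun x => ⁅x, c q⁆) fun x y => add_lie x y (c q)) k X m p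

/-- If `(z-w)^K X = 0` and `(z-u)^N (w-u)^N [X(z,w), c(u)] = 0`, then `Res_z X` and `c` are
mutually local. -/
theorem mutuallyLocal_resZ {X : Dist₂ L} {c : Dist L} {K N : ℕ} (hX : mulSub^[K] X = 0)
    (h : (mulSub₁₃ L ^ N) ((mulSub₂₃ L ^ N) (bracket₃ X c)) = 0) : MutuallyLocal (resZ X) c := by
  have h1 : (mulSub₁₂ L ^ K) (bracket₃ X c) = 0 := by
    rw [mulSub₁₂_pow_bracket₃, hX]
    funext m p q
    simp [bracket₃]
  have h2 := mulSub₂₃_pow_eq_zero h1 h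
  refine mutuallyLocal_iff.2 ⟨N + K + N, ?_⟩
  funext p q
  -- Multiplication by `w - u` does not touch `z`, so it commutes with `Res_z`, which is the
  -- coefficient with first index `0`.
  have := congrFun (congrFun (congrFun h2 0) p) q
  rwa [mulSub₂₃_pow_apply] at this

theorem mulSub₁₃_pow_mulSub₂₃_pow_eq_zero {f g : Dist₃ M} {N : ℕ}
    (hf : (mulSub₂₃ M ^ N) f = 0) (hg : (mulSub₁₃ M ^ N) g = 0) :
    (mulSub₁₃ M ^ N) ((mulSub₂₃ M ^ N) (f + g)) = 0 := by
  rw [map_add, hf, zero_add, ← Module.End.mul_apply,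
    ((commute_mulSub₁₃_mulSub₂₃ M).pow_pow N N).eq, Module.End.mul_apply, hg, map_zero]

/-- By the Jacobi identity `[[a, b], c] = [a, [b, c]] - [b, [a, c]]`, where `(w - u)^N` kills the
first term and `(z - u)^N` the second. The extra factor `(z - w)^n` commutes with both. -/
theorem MutuallyLocal.natProd_left {a b c : Dist L} (hab : MutuallyLocal a b)
    (hac : MutuallyLocal a c) (hbc : MutuallyLocal b c) (n : ℕ) :
    MutuallyLocal (natProd n a b) c := by
  obtain ⟨K, hK⟩ := mutuallyLocal_iff.1 hab
  obtain ⟨N, hN, hN'⟩ := (hac.and hbc).exists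
  refine mutuallyLocal_resZ (K := K) (N := N) ?_ ?_
  · rw [← Function.iterate_add_apply]
    exact mulSub_iterate_eq_zero_of_le hK (Nat.le_add_right K n)
  · have e : bracket₃ (bracket₂ a b) c =
        (fun m p q => ⁅a m, ⁅b p, c q⁆⁆) + fun m p q => -⁅b p, ⁅a m, c q⁆⁆ := by
      funext m p q
      simp only [bracket₃, bracket₂, Pi.add_apply]
      rw [lie_lie, sub_eq_add_neg]
    have hz : (mulSub₁₃ L ^ N) ((mulSub₂₃ L ^ N) (bracket₃ (bracket₂ a b) c)) = 0 := by
      rw [e]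
      refine mulSub₁₃_pow_mulSub₂₃_pow_eq_zero ?_ ?_
      · funext m p q
        rw [mulSub₂₃_pow_apply]
        refine (mulSub_iterate_map ((LieModule.toEnd ℤ L L (a m)).toAddMonoidHom) N (bracket₂ b c) p q).trans ?_
        rw [hN', Pi.zero_apply, Pi.zero_apply, map_zero, Pi.zero_apply, Pi.zero_apply]
        rfl
      · funext m p q
        rw [mulSub₁₃_pow_apply]
        refine (mulSub_iterate_map (-(LieModule.toEnd ℤ L L (b p)).toAddMonoidHom) N (bracket₂ a c) m q).trans ?_
        rw [hN, Pi.zero_apply, Pi.zero_apply, map_zero, Pi.zero_apply, Pi.zero_apply]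
        rfl
    rw [← mulSub₁₂_pow_bracket₃, ← Module.End.mul_apply (mulSub₂₃ L ^ N),
      ← ((commute_mulSub₁₂_mulSub₂₃ L).pow_pow n N).eq, Module.End.mul_apply,
      ← Module.End.mul_apply (mulSub₁₃ L ^ N),
      ← ((commute_mulSub₁₂_mulSub₁₃ L).pow_pow n N).eq, Module.End.mul_apply, hz, map_zero]

end Dong

/-! ### The kernel of the normally ordered product -/

theorem finsum_nat_eq_zero_add {M : Type*} [AddCommMonoid M] (f : ℕ → M)
    (hf : (Function.support f).Finite) : ∑ᶠ k, f k = f 0 + ∑ᶠ k, f (k + 1) := by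
  obtain ⟨N, hN⟩ := hf.bddAbove
  have h1 : Function.support f ⊆ Finset.range (N + 1) := by
    intro k hk
    have := hN hk
    simp only [Finset.coe_range, Set.mem_Iio]
    omega
  have h2 : (Function.support fun k => f (k + 1)) ⊆ Finset.range N := by
    intro k hk
    have := hN (show k + 1 ∈ Function.support f from hk)
    simp only [Finset.coe_range, Set.mem_Iio]
    omega
  rw [finsum_eq_sum_of_support_subset f h1, finsum_eq_sum_of_support_subset _ h2,
    Finset.sum_range_succ', add_comm]

theorem finsum_nat_succ_sub {M : Type*} [AddCommGroup M] (f : ℕ → M)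
    (hf : (Function.support f).Finite) : ∑ᶠ k, (f (k + 1) - f k) = -f 0 := by
  have h : (Function.support fun k => f (k + 1)).Finite :=
    hf.preimage (f := fun k => k + 1) (add_left_injective 1).injOn
  rw [finsum_sub_distrib h hf, finsum_nat_eq_zero_add f hf]
  abel

/-- Made for the Leibniz rule on normally ordered products, whose index-dependent factors collect
into differences of consecutive terms. Finite support removes the boundary term at infinity and `h 0
= 0` the one at the start. -/
theorem finsum_eq_of_telescoping {M : Type*} [AddCommGroup M] {f g h : ℕ → M} (c : ℤ)
    (hg : (Function.support g).Finite) (hh : (Function.support h).Finite) (h0 : h 0 = 0)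
    (hf : ∀ k, f k = c • g k + (h (k + 1) - h k)) : ∑ᶠ k, f k = c • ∑ᶠ k, g k := by
  have h1 : (Function.support fun k => h (k + 1)).Finite :=
    hh.preimage (f := fun k => k + 1) (add_left_injective 1).injOn
  have h2 : (Function.support fun k => c • g k).Finite :=
    hg.subset fun k hk hk0 => hk (by simp [hk0])
  rw [finsum_congr hf, finsum_add_distrib h2 ((h1.union hh).subset (Function.support_sub _ _)),
    finsum_nat_succ_sub h hh, h0, neg_zero, add_zero, smul_finsum' c hg]

theorem finsum_map_sub {ι M N F : Type*} [AddCommGroup M] [AddCommGroup N] [FunLike F M N]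
    [AddMonoidHomClass F M N] (φ : F) {f : ι → M} {g : ι → N} (hf : (Function.support f).Finite)
    (hg : (Function.support g).Finite) :
    ∑ᶠ k, (φ (f k) - g k) = φ (∑ᶠ k, f k) - ∑ᶠ k, g k := by
  rw [map_finsum φ hf]
  exact finsum_sub_distrib (hf.subset (Function.support_comp_subset (map_zero φ) f)) hg

theorem finsum_sub_map {ι M N F : Type*} [AddCommGroup M] [AddCommGroup N] [FunLike F M N]
    [AddMonoidHomClass F M N] (φ : F) {f : ι → M} {g : ι → N} (hf : (Function.support f).Finite)
    (hg : (Function.support g).Finite) :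
    ∑ᶠ k, (g k - φ (f k)) = ∑ᶠ k, g k - φ (∑ᶠ k, f k) := by
  rw [map_finsum φ hf]
  exact finsum_sub_distrib hg (hf.subset (Function.support_comp_subset (map_zero φ) f))

section Fields

variable {R V : Type*} [CommRing R] [AddCommGroup V] [Module R V]

instance [IsAddTorsionFree V] : IsAddTorsionFree (Module.End R V) where
  nsmul_right_injective n hn f g h := by
    ext v
    exact nsmul_right_injective hn (DFunLike.congr_fun h v)

/-- The field `z^m a(z)`. -/
def shiftField (m : ℤ) (a : Fields R V) : Fields R V :=
  ⟨fun n => a.1 (n + m), fun v =>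
    (tendsto_atTop_add_const_right atTop m tendsto_id).eventually (a.2 v)⟩

/-- The expansion of `(z - w)^{-1} [a(z), b(w)]`, in `|z| > |w|` for `a(z) b(w)` and in
`|w| > |z|` for `b(w) a(z)`. Its residue is `:a(w) b(w):`. -/
def normalKernel (a b : Fields R V) : Dist₂ (Module.End R V) :=
  fun m p => normalCoeff (shiftField m a) b p

theorem normalKernel_apply (a b : Fields R V) (m p : ℤ) (v : V) :
    normalKernel a b m p v = (∑ᶠ k : ℕ, a.1 (-(k : ℤ) - 1 + m) (b.1 (p + k) v)) +
      ∑ᶠ k : ℕ, b.1 (p - 1 - k) (a.1 (k + m) v) := rfl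

theorem resZ_normalKernel (a b : Fields R V) : resZ (normalKernel a b) = (normalProd a b).1 := by
  have h : shiftField 0 a = a := by
    apply Subtype.ext
    funext n
    simp [shiftField]
  funext p
  simp only [resZ, normalKernel, h]
  rfl

/-- In each of the two sums the shifts of `m` and `p` amount to moving `k` by one, so all terms
cancel except those with `k = 0`, which are `a_(m) b_(p)` and `-b_(p) a_(m)`. -/
theorem mulSub_normalKernel (a b : Fields R V) :
    mulSub (normalKernel a b) = bracket₂ a.1 b.1 := by
  funext m p
  ext v
  have hl := finsum_nat_eq_zero_add (fun k : ℕ => a.1 (-(k : ℤ) - 1 + (m + 1)) (b.1 (p + k) v))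
    (normal_finite_left (shiftField (m + 1) a) b p v)
  have hr := finsum_nat_eq_zero_add (fun k : ℕ => b.1 (p + 1 - 1 - k) (a.1 (k + m) v))
    (normal_finite_right (shiftField m a) b (p + 1) v)
  have el : ∀ k : ℕ, a.1 (-(k : ℤ) - 1 + m) (b.1 (p + 1 + k) v) =
      a.1 (-((k + 1 : ℕ) : ℤ) - 1 + (m + 1)) (b.1 (p + (k + 1 : ℕ)) v) := by
    intro k
    rw [show -((k + 1 : ℕ) : ℤ) - 1 + (m + 1) = -k - 1 + m by push_cast; ring,
      show p + ((k + 1 : ℕ) : ℤ) = p + 1 + k by push_cast; ring]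
  have er : ∀ k : ℕ, b.1 (p - 1 - k) (a.1 (k + (m + 1)) v) =
      b.1 (p + 1 - 1 - (k + 1 : ℕ)) (a.1 ((k + 1 : ℕ) + m) v) := by
    intro k
    rw [show p + 1 - 1 - ((k + 1 : ℕ) : ℤ) = p - 1 - k by push_cast; ring,
      show ((k + 1 : ℕ) : ℤ) + m = k + (m + 1) by push_cast; ring]
  simp only [mulSub, LinearMap.sub_apply, normalKernel_apply, bracket₂,
    LieRing.of_associative_ring_bracket, Module.End.mul_apply]
  rw [hl, hr, finsum_congr el, finsum_congr er]
  simp only [Nat.cast_zero, neg_zero, zero_sub, add_zero, zero_add, sub_zero,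
    add_sub_cancel_right, neg_add_cancel_comm_assoc]
  abel

/-! ### Dong's lemma for normally ordered products -/

section Dong

variable {M : Type*} [AddCommGroup M]

/-- The distribution with coefficients `∑_k G(m + σ k, p + τ k, q)`. -/
def reindexSum (σ τ : ℕ → ℤ) (G : Dist₃ M) : Dist₃ M :=
  fun m p q => ∑ᶠ k, G (m + σ k) (p + τ k) q

/-- All the sums in `reindexSum` are finite. -/
def ReindexFinite (σ τ : ℕ → ℤ) (G : Dist₃ M) : Prop :=
  ∀ m p q, (Function.support fun k => G (m + σ k) (p + τ k) q).Finite

variable {σ τ : ℕ → ℤ} {G : Dist₃ M}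

theorem ReindexFinite.mulSub₁₃ (hG : ReindexFinite σ τ G) :
    ReindexFinite σ τ (mulSub₁₃ M G) := by
  intro m p q
  refine ((hG (m + 1) p q).union (hG m p (q + 1))).subset ?_
  simp only [mulSub₁₃_apply, add_right_comm m]
  exact Function.support_sub _ _

theorem ReindexFinite.mulSub₂₃ (hG : ReindexFinite σ τ G) :
    ReindexFinite σ τ (mulSub₂₃ M G) := by
  intro m p q
  refine ((hG m (p + 1) q).union (hG m p (q + 1))).subset ?_
  simp only [mulSub₂₃_apply, add_right_comm p]
  exact Function.support_sub _ _

theorem reindexSum_mulSub₁₃ (hG : ReindexFinite σ τ G) :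
    reindexSum σ τ (mulSub₁₃ M G) = mulSub₁₃ M (reindexSum σ τ G) := by
  funext m p q
  simp only [mulSub₁₃_apply, reindexSum, add_right_comm m _ (1 : ℤ)]
  exact finsum_sub_distrib (hG (m + 1) p q) (hG m p (q + 1))

theorem reindexSum_mulSub₂₃ (hG : ReindexFinite σ τ G) :
    reindexSum σ τ (mulSub₂₃ M G) = mulSub₂₃ M (reindexSum σ τ G) := by
  funext m p q
  simp only [mulSub₂₃_apply, reindexSum, add_right_comm p _ (1 : ℤ)]
  exact finsum_sub_distrib (hG m (p + 1) q) (hG m p (q + 1))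

theorem ReindexFinite.mulSub₁₃_pow (hG : ReindexFinite σ τ G) (k : ℕ) :
    ReindexFinite σ τ ((LieVertex.mulSub₁₃ M ^ k) G) ∧
      reindexSum σ τ ((LieVertex.mulSub₁₃ M ^ k) G) =
        (LieVertex.mulSub₁₃ M ^ k) (reindexSum σ τ G) := by
  induction k with
  | zero => exact ⟨hG, rfl⟩
  | succ k ih =>
    rw [pow_succ', Module.End.mul_apply, Module.End.mul_apply, ← ih.2, reindexSum_mulSub₁₃ ih.1]
    exact ⟨ih.1.mulSub₁₃, rfl⟩

theorem ReindexFinite.mulSub₂₃_pow (hG : ReindexFinite σ τ G) (k : ℕ) :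
    ReindexFinite σ τ ((LieVertex.mulSub₂₃ M ^ k) G) ∧
      reindexSum σ τ ((LieVertex.mulSub₂₃ M ^ k) G) =
        (LieVertex.mulSub₂₃ M ^ k) (reindexSum σ τ G) := by
  induction k with
  | zero => exact ⟨hG, rfl⟩
  | succ k ih =>
    rw [pow_succ', Module.End.mul_apply, Module.End.mul_apply, ← ih.2, reindexSum_mulSub₂₃ ih.1]
    exact ⟨ih.1.mulSub₂₃, rfl⟩

/-- Multiplication by `z - u` or `w - u` commutes with index shifts in `z` and `w`, hence with
finite sums of them. -/
theorem ReindexFinite.mulSub_pow_reindexSum_eq_zero (hG : ReindexFinite σ τ G) {N : ℕ}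
    (h : (LieVertex.mulSub₁₃ M ^ N) ((LieVertex.mulSub₂₃ M ^ N) G) = 0) :
    (LieVertex.mulSub₁₃ M ^ N) ((LieVertex.mulSub₂₃ M ^ N) (reindexSum σ τ G)) = 0 := by
  obtain ⟨h1, h2⟩ := hG.mulSub₂₃_pow N
  rw [← h2, ← (h1.mulSub₁₃_pow N).2, h]
  funext m p q
  simp [reindexSum]

theorem mulSub₁₃_pow_map {M' : Type*} [AddCommGroup M'] (φ : M →+ M') (k : ℕ) (f : Dist₃ M) :
    (mulSub₁₃ M' ^ k) (fun m p q => φ (f m p q)) = fun m p q => φ ((mulSub₁₃ M ^ k) f m p q) := by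
  funext m p q
  rw [mulSub₁₃_pow_apply, mulSub₁₃_pow_apply]
  exact mulSub_iterate_map φ k (fun m q => f m p q) m q

theorem mulSub₂₃_pow_map {M' : Type*} [AddCommGroup M'] (φ : M →+ M') (k : ℕ) (f : Dist₃ M) :
    (mulSub₂₃ M' ^ k) (fun m p q => φ (f m p q)) = fun m p q => φ ((mulSub₂₃ M ^ k) f m p q) := by
  funext m p q
  rw [mulSub₂₃_pow_apply, mulSub₂₃_pow_apply]
  exact mulSub_iterate_map φ k (f m) p q

/-- In an associative algebra, `(z-u)^N (w-u)^N [a(z) b(w), c(u)] = 0` when `(z-u)^N` kills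
`[a(z), c(u)]` and `(w-u)^N` kills `[b(w), c(u)]`. -/
theorem mulSub_pow_bracket₃_mul {A : Type*} [Ring A] {a b c : Dist A} {N : ℕ}
    (hac : mulSub^[N] (bracket₂ a c) = 0) (hbc : mulSub^[N] (bracket₂ b c) = 0) :
    (mulSub₁₃ A ^ N) ((mulSub₂₃ A ^ N) (bracket₃ (fun m p => a m * b p) c)) = 0 := by
  have e : bracket₃ (fun m p => a m * b p) c =
      (fun m p q => a m * ⁅b p, c q⁆) + fun m p q => ⁅a m, c q⁆ * b p := by
    funext m p q
    simp only [bracket₃, Pi.add_apply, LieRing.of_associative_ring_bracket]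
    noncomm_ring
  rw [e]
  refine mulSub₁₃_pow_mulSub₂₃_pow_eq_zero ?_ ?_
  · funext m p q
    rw [mulSub₂₃_pow_apply]
    refine (mulSub_iterate_map (AddMonoidHom.mulLeft (a m)) N (bracket₂ b c) p q).trans ?_
    rw [hbc]
    simp
  · funext m p q
    rw [mulSub₁₃_pow_apply]
    refine (mulSub_iterate_map (AddMonoidHom.mulRight (b p)) N (bracket₂ a c) m q).trans ?_
    rw [hac]
    simp

/-- The same as `mulSub_pow_bracket₃_mul` for the opposite product. -/
theorem mulSub_pow_bracket₃_mul_swap {A : Type*} [Ring A] {a b c : Dist A} {N : ℕ}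
    (hac : mulSub^[N] (bracket₂ a c) = 0) (hbc : mulSub^[N] (bracket₂ b c) = 0) :
    (mulSub₁₃ A ^ N) ((mulSub₂₃ A ^ N) (bracket₃ (fun m p => b p * a m) c)) = 0 := by
  have e : bracket₃ (fun m p => b p * a m) c =
      (fun m p q => ⁅b p, c q⁆ * a m) + fun m p q => b p * ⁅a m, c q⁆ := by
    funext m p q
    simp only [bracket₃, Pi.add_apply, LieRing.of_associative_ring_bracket]
    noncomm_ring
  rw [e]
  refine mulSub₁₃_pow_mulSub₂₃_pow_eq_zero ?_ ?_
  · funext m p q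
    rw [mulSub₂₃_pow_apply]
    refine (mulSub_iterate_map (AddMonoidHom.mulRight (a m)) N (bracket₂ b c) p q).trans ?_
    rw [hbc]
    simp
  · funext m p q
    rw [mulSub₁₃_pow_apply]
    refine (mulSub_iterate_map (AddMonoidHom.mulLeft (b p)) N (bracket₂ a c) m q).trans ?_
    rw [hac]
    simp

end Dong

theorem finite_support_mul_left (a b c : Fields R V) (m p q : ℤ) (v : V) :
    (Function.support fun k : ℕ =>
      bracket₃ (fun m p => a.1 m * b.1 p) c.1 (m + (-(k : ℤ) - 1)) (p + k) q v).Finite := by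
  refine ((normal_finite_left (shiftField m a) b p (c.1 q v)).union
    (normal_finite_left (shiftField m a) b p v)).subset fun k hk => ?_
  by_contra h
  simp only [Set.mem_union, Function.mem_support, not_or, not_not] at h
  apply hk
  have h1 : a.1 (-(k : ℤ) - 1 + m) (b.1 (p + k) (c.1 q v)) = 0 := h.1
  have h2 : a.1 (-(k : ℤ) - 1 + m) (b.1 (p + k) v) = 0 := h.2
  rw [add_comm] at h1 h2
  simp only [bracket₃, LieRing.of_associative_ring_bracket, LinearMap.sub_apply,
    Module.End.mul_apply, h1, h2, map_zero, sub_zero]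

theorem finite_support_mul_right (a b c : Fields R V) (m p q : ℤ) (v : V) :
    (Function.support fun k : ℕ =>
      bracket₃ (fun m p => b.1 p * a.1 m) c.1 (m + k) (p + (-1 - (k : ℤ))) q v).Finite := by
  refine ((normal_finite_right (shiftField m a) b p (c.1 q v)).union
    (normal_finite_right (shiftField m a) b p v)).subset fun k hk => ?_
  by_contra h
  simp only [Set.mem_union, Function.mem_support, not_or, not_not] at h
  apply hk
  have h1 : b.1 (p - 1 - k) (a.1 (k + m) (c.1 q v)) = 0 := h.1
  have h2 : b.1 (p - 1 - k) (a.1 (k + m) v) = 0 := h.2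
  rw [add_comm, show p - 1 - (k : ℤ) = p + (-1 - k) by ring] at h1 h2
  simp only [bracket₃, LieRing.of_associative_ring_bracket, LinearMap.sub_apply,
    Module.End.mul_apply, h1, h2, map_zero, sub_zero]

/-- The two pairs of shifts are the two geometric expansions of `(z - w)^{-1}`. The vector `v` is
needed because the sums are finite only after evaluation. -/
theorem bracket₃_normalKernel_apply (a b c : Fields R V) (v : V) :
    (fun m p q => bracket₃ (normalKernel a b) c.1 m p q v) =
      reindexSum (fun k => -(k : ℤ) - 1) (fun k => (k : ℤ))
        (fun m p q => bracket₃ (fun m p => a.1 m * b.1 p) c.1 m p q v) +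
      reindexSum (fun k => (k : ℤ)) (fun k => -1 - (k : ℤ))
        (fun m p q => bracket₃ (fun m p => b.1 p * a.1 m) c.1 m p q v) := by
  funext m p q
  have fl := fun v => normal_finite_left (shiftField m a) b p v
  have fr := fun v => normal_finite_right (shiftField m a) b p v
  have hl := finsum_sub_map (c.1 q) (fl v) (fl (c.1 q v))
  have hr := finsum_sub_map (c.1 q) (fr v) (fr (c.1 q v))
  simp only [Pi.add_apply, reindexSum]
  simp only [bracket₃, LieRing.of_associative_ring_bracket, LinearMap.sub_apply,
    Module.End.mul_apply, normalKernel_apply, map_add]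
  refine (add_sub_add_comm _ _ _ _).trans ((congrArg₂ (· + ·) hl hr).symm.trans ?_)
  simp only [shiftField]
  congr 1
  · refine finsum_congr fun k => ?_
    rw [add_comm m]
  · refine finsum_congr fun k => ?_
    rw [add_comm m, show p - 1 - (k : ℤ) = p + (-1 - k) by ring]

theorem MutuallyLocal.normalProd_left {a b c : Fields R V} (hab : MutuallyLocal a.1 b.1)
    (hac : MutuallyLocal a.1 c.1) (hbc : MutuallyLocal b.1 c.1) :
    MutuallyLocal (normalProd a b).1 c.1 := by
  obtain ⟨K, hK⟩ := mutuallyLocal_iff.1 hab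
  obtain ⟨N, hN, hN'⟩ := (hac.and hbc).exists
  rw [← resZ_normalKernel]
  -- One power of `z - w` clears the denominator of the kernel, the other `K` kill `[a(z), b(w)]`.
  refine mutuallyLocal_resZ (K := K + 1) (N := N) ?_ ?_
  · rw [Function.iterate_succ_apply, mulSub_normalKernel, hK]
  · funext m p q
    ext v
    set Y := bracket₃ (normalKernel a b) c.1
    let ev : Module.End R V →+ V := (LinearMap.applyₗ (R := R) (M₂ := V) v).toAddMonoidHom
    have h2 := mulSub₁₃_pow_map ev N ((mulSub₂₃ (Module.End R V) ^ N) Y)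
    rw [← mulSub₂₃_pow_map ev N Y] at h2
    refine (congrFun (congrFun (congrFun h2 m) p) q).symm.trans ?_
    have hv := bracket₃_normalKernel_apply a b c v
    have hz : ∀ G : Dist₃ (Module.End R V), (mulSub₁₃ (Module.End R V) ^ N)
        ((mulSub₂₃ (Module.End R V) ^ N) G) = 0 →
        (mulSub₁₃ V ^ N) ((mulSub₂₃ V ^ N) fun m p q => G m p q v) = 0 := by
      intro G hG
      refine (congrArg _ (mulSub₂₃_pow_map ev N G)).trans ((mulSub₁₃_pow_map ev N _).trans ?_)
      rw [hG]
      funext m p q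
      simp
    have e1 := ReindexFinite.mulSub_pow_reindexSum_eq_zero
      (fun m p q => finite_support_mul_left a b c m p q v) (hz _ (mulSub_pow_bracket₃_mul hN hN'))
    have e2 := ReindexFinite.mulSub_pow_reindexSum_eq_zero
      (fun m p q => finite_support_mul_right a b c m p q v)
      (hz _ (mulSub_pow_bracket₃_mul_swap hN hN'))
    have e3 : (mulSub₁₃ V ^ N) ((mulSub₂₃ V ^ N)
        fun m p q => Y m p q v) = 0 := by
      rw [hv, map_add, map_add, e1, e2, add_zero]
    exact congrFun (congrFun (congrFun e3 m) p) q

theorem MutuallyLocal.nthProd_left [IsAddTorsionFree V] {a b c : Fields R V}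
    (hab : MutuallyLocal a.1 b.1) (hac : MutuallyLocal a.1 c.1) (hbc : MutuallyLocal b.1 c.1)
    (n : ℤ) : MutuallyLocal (nthProd n a b).1 c.1 := by
  cases n with
  | ofNat n => exact hab.natProd_left hac hbc n
  | negSucc m =>
    exact MutuallyLocal.normalProd_left (a := hasseField m a) (hab.hasseZ_left m)
      (hac.hasseZ_left m) hbc

theorem mutuallyLocal_idField (a : Dist (Module.End R V)) : MutuallyLocal (idField R V).1 a := by
  refine mutuallyLocal_iff.2 ⟨0, ?_⟩
  funext m n
  by_cases hm : m = -1
  · subst hm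
    simp [bracket₂, idField, LieRing.of_associative_ring_bracket]
  · simp [bracket₂, idField, hm]

/-- The fields that are mutually local with all members of `S`. -/
def localCommutant (S : Set (Fields R V)) : Submodule R (Fields R V) where
  carrier := {φ | ∀ ψ ∈ S, MutuallyLocal φ.1 ψ.1}
  zero_mem' := fun ψ _ => mutuallyLocal_zero_left ψ.1
  add_mem' := fun ha hb ψ hψ => (ha ψ hψ).add_left (hb ψ hψ)
  smul_mem' := fun r _ ha ψ hψ => (ha ψ hψ).smul_left r

/-! ### Generated fields -/

theorem generatedFields_le {F : Set (Fields R V)} {S : Submodule R (Fields R V)} (hF : F ⊆ S)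
    (hid : idField R V ∈ S)
    (hS : ∀ (n : ℤ) (a b : Fields R V), a ∈ S → b ∈ S → nthProd n a b ∈ S) :
    generatedFields F ≤ S :=
  sInf_le ⟨hF, hid, hS⟩

theorem subset_generatedFields (F : Set (Fields R V)) : F ⊆ generatedFields F := by
  intro a ha
  exact Submodule.mem_sInf.2 fun S hS => hS.1 ha

theorem idField_mem_generatedFields (F : Set (Fields R V)) : idField R V ∈ generatedFields F :=
  Submodule.mem_sInf.2 fun _ hS => hS.2.1

theorem nthProd_mem_generatedFields {F : Set (Fields R V)} (n : ℤ) {a b : Fields R V}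
    (ha : a ∈ generatedFields F) (hb : b ∈ generatedFields F) :
    nthProd n a b ∈ generatedFields F :=
  Submodule.mem_sInf.2 fun S hS =>
    hS.2.2 n a b (Submodule.mem_sInf.1 ha S hS) (Submodule.mem_sInf.1 hb S hS)

/-- A double commutant argument. Dong's lemma for `a, b` against `c` also needs `a` and `b` to be
local with each other, which membership in the commutant of `F` does not give. As `F` lies in its
own commutant, its double commutant lies in the commutant too, so any two members of the double
commutant are mutually local. -/
theorem mutuallyLocal_of_mem_generatedFields [IsAddTorsionFree V] {F : Set (Fields R V)}
    (hF : ∀ a ∈ F, ∀ b ∈ F, MutuallyLocal a.1 b.1) {a b : Fields R V}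
    (ha : a ∈ generatedFields F) (hb : b ∈ generatedFields F) : MutuallyLocal a.1 b.1 := by
  have hsub : F ⊆ localCommutant F := fun a ha b hb => hF a ha b hb
  have hle : generatedFields F ≤ localCommutant (localCommutant F : Set (Fields R V)) := by
    refine generatedFields_le (fun a ha b hb => (hb a ha).symm)
      (fun b _ => mutuallyLocal_idField b.1) fun n a b ha hb c hc => ?_
    exact MutuallyLocal.nthProd_left (ha b fun c hc => hb c (hsub hc)) (ha c hc) (hb c hc) n
  exact hle ha b fun c hc => hle hb c (hsub hc)

/-! ### Translation covariance -/

/-- `[T, a(z)] = ∂_z a(z)`. -/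
def TranslationCovariant (T : Module.End R V) (a : Dist (Module.End R V)) : Prop :=
  ∀ n, T * a n - a n * T = derivZ a n

section Translation

variable {T : Module.End R V}

theorem TranslationCovariant.derivZ {a : Dist (Module.End R V)} (h : TranslationCovariant T a) :
    TranslationCovariant T (derivZ a) := by
  intro n
  have := h (n - 1)
  simp only [LieVertex.derivZ] at this ⊢
  rw [mul_smul_comm, smul_mul_assoc, ← smul_sub, this]

theorem TranslationCovariant.of_nsmul [IsAddTorsionFree V] {a : Dist (Module.End R V)} {k : ℕ}
    (hk : k ≠ 0) (h : TranslationCovariant T (k • a)) : TranslationCovariant T a := by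
  intro n
  apply nsmul_right_injective hk
  have := h n
  simp only [LieVertex.derivZ, Pi.smul_apply, mul_smul_comm, smul_mul_assoc] at this ⊢
  rw [smul_sub, this, smul_comm]

theorem TranslationCovariant.hasseZ [IsAddTorsionFree V] {a : Dist (Module.End R V)}
    (h : TranslationCovariant T a) (m : ℕ) : TranslationCovariant T (hasseZ m a) := by
  induction m with
  | zero => rwa [hasseZ_zero]
  | succ m ih =>
    have := ih.derivZ
    rw [derivZ_hasseZ] at this
    exact this.of_nsmul m.succ_ne_zero

/-- The operator `∂_z + ∂_w` kills `z - w`, so `[T, -]` acts as `∂_z + ∂_w` on every `(z - w)^n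
[a(z), b(w)]`; the residue in `z` of a `z`-derivative is zero. -/
theorem TranslationCovariant.natProd {a b : Dist (Module.End R V)}
    (ha : TranslationCovariant T a) (hb : TranslationCovariant T b) (n : ℕ) :
    TranslationCovariant T (natProd n a b) := by
  have key : ∀ (n : ℕ) (m p : ℤ), T * mulSub^[n] (bracket₂ a b) m p -
      mulSub^[n] (bracket₂ a b) m p * T = (-m) • mulSub^[n] (bracket₂ a b) (m - 1) p +
        (-p) • mulSub^[n] (bracket₂ a b) m (p - 1) := by
    intro n
    induction n with
    | zero =>
      intro m p
      have h1 := ha m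
      have h2 := hb p
      simp only [LieVertex.derivZ] at h1 h2
      have e : T * (a m * b p - b p * a m) - (a m * b p - b p * a m) * T =
          (T * a m - a m * T) * b p + a m * (T * b p - b p * T) -
            ((T * b p - b p * T) * a m + b p * (T * a m - a m * T)) := by
        noncomm_ring
      simp only [Function.iterate_zero, id, bracket₂, LieRing.of_associative_ring_bracket]
      rw [e, h1, h2]
      simp only [smul_mul_assoc, mul_smul_comm]
      module
    | succ n ih =>
      intro m p
      simp only [mulSub_iterate_succ, mul_sub, sub_mul]
      have h1 := ih (m + 1) p
      have h2 := ih m (p + 1)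
      rw [add_sub_cancel_right] at h1 h2
      rw [sub_sub_sub_comm, h1, h2, sub_add_cancel, sub_add_cancel]
      module
  intro p
  have := key n 0 p
  simpa [LieVertex.natProd, resZ, LieVertex.derivZ] using this

theorem TranslationCovariant.normalProd {a b : Fields R V} (ha : TranslationCovariant T a.1)
    (hb : TranslationCovariant T b.1) : TranslationCovariant T (normalProd a b).1 := by
  have ha' : ∀ n v, T (a.1 n v) = a.1 n (T v) + (-n) • a.1 (n - 1) v := by
    intro n v
    rw [← sub_eq_iff_eq_add']
    exact LinearMap.congr_fun (ha n) v
  have hb' : ∀ n v, T (b.1 n v) = b.1 n (T v) + (-n) • b.1 (n - 1) v := by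
    intro n v
    rw [← sub_eq_iff_eq_add']
    exact LinearMap.congr_fun (hb n) v
  intro p
  ext v
  have hl := finsum_eq_of_telescoping
    (f := fun k : ℕ => T (a.1 (-(k : ℤ) - 1) (b.1 (p + k) v)) -
      a.1 (-(k : ℤ) - 1) (b.1 (p + k) (T v)))
    -- The derivatives of the two factors contribute `k + 1` and `-(p + k)`: the `-p` part is the
    -- wanted coefficient, the rest is `h (k + 1) - h k`. The second sum works in the same way.
    (h := fun k : ℕ => (k : ℤ) • a.1 (-(k : ℤ) - 1) (b.1 (p - 1 + k) v)) (-p)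
    (normal_finite_left a b (p - 1) v)
    ((normal_finite_left a b (p - 1) v).subset fun k hk hk0 => hk (by simp [hk0]))
    (by simp) fun k => by
      simp only [ha', hb', map_add, map_zsmul]
      rw [show -((k + 1 : ℕ) : ℤ) - 1 = -k - 1 - 1 by push_cast; ring,
        show p - 1 + ((k + 1 : ℕ) : ℤ) = p + k by push_cast; ring,
        show p + (k : ℤ) - 1 = p - 1 + k by ring]
      push_cast
      module
  have hr := finsum_eq_of_telescoping
    (f := fun k : ℕ => T (b.1 (p - 1 - k) (a.1 k v)) - b.1 (p - 1 - k) (a.1 k (T v)))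
    (h := fun k : ℕ => (k : ℤ) • b.1 (p - 1 - k) (a.1 (k - 1) v)) (-p)
    (normal_finite_right a b (p - 1) v)
    ((normal_finite_right (shiftField (-1) a) b p v).subset fun k hk hk0 => hk (by
      simp only [shiftField, ← sub_eq_add_neg] at hk0
      simp [hk0]))
    (by simp) fun k => by
      simp only [ha', hb', map_add, map_zsmul]
      rw [show p - 1 - ((k + 1 : ℕ) : ℤ) = p - 1 - 1 - k by push_cast; ring,
        show ((k + 1 : ℕ) : ℤ) - 1 = k by push_cast; ring,
        show p - 1 - (k : ℤ) - 1 = p - 1 - 1 - k by ring]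
      push_cast
      module
  have hl' := finsum_map_sub T (normal_finite_left a b p v) (normal_finite_left a b p (T v))
  have hr' := finsum_map_sub T (normal_finite_right a b p v) (normal_finite_right a b p (T v))
  change T (normalCoeff a b p v) - normalCoeff a b p (T v) = (-p) • normalCoeff a b (p - 1) v
  refine (congrArg (· - _) (map_add T _ _)).trans ((add_sub_add_comm _ _ _ _).trans ?_)
  rw [← hl', ← hr', hl, hr, ← smul_add]
  rfl

theorem TranslationCovariant.nthProd [IsAddTorsionFree V] {a b : Fields R V}
    (ha : TranslationCovariant T a.1) (hb : TranslationCovariant T b.1) (n : ℤ) :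
    TranslationCovariant T (nthProd n a b).1 := by
  cases n with
  | ofNat n => exact ha.natProd hb n
  | negSucc m => exact TranslationCovariant.normalProd (a := hasseField m a) (ha.hasseZ m) hb

theorem translationCovariant_idField : TranslationCovariant T (idField R V).1 := by
  intro n
  simp only [idField, LieVertex.derivZ]
  by_cases hn : n = -1
  · subst hn
    simp
  · by_cases hn0 : n = 0
    · subst hn0
      simp
    · rw [Pi.single_eq_of_ne hn, Pi.single_eq_of_ne (by omega)]
      simp

variable (T) in
/-- The translation covariant fields. -/
def covariantFields : Submodule R (Fields R V) where
  carrier := {φ | TranslationCovariant T φ.1}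
  zero_mem' n := by simp [LieVertex.derivZ]
  add_mem' {a b} ha hb n := by
    have h1 := ha n
    have h2 := hb n
    simp only [LieVertex.derivZ] at h1 h2
    simp only [LieVertex.derivZ, Submodule.coe_add, Pi.add_apply, mul_add, add_mul, smul_add,
      ← h1, ← h2]
    abel
  smul_mem' r a ha n := by
    have h1 := ha n
    simp only [LieVertex.derivZ] at h1
    simp only [LieVertex.derivZ, Submodule.coe_smul, Pi.smul_apply, mul_smul_comm, smul_mul_assoc,
      ← smul_sub, h1, smul_comm r]

theorem translationCovariant_of_mem_generatedFields [IsAddTorsionFree V] {F : Set (Fields R V)}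
    (hF : ∀ a ∈ F, TranslationCovariant T a.1) {a : Fields R V} (ha : a ∈ generatedFields F) :
    TranslationCovariant T a.1 :=
  generatedFields_le (S := covariantFields T) hF translationCovariant_idField
    (fun n _ _ ha hb => TranslationCovariant.nthProd ha hb n) ha

end Translation

/-! ### The action of fields on the vacuum -/

section Vacuum

variable {vac : V}

/-- `a(z) vac ∈ V[[z]]`. -/
def Creates (vac : V) (a : Dist (Module.End R V)) : Prop :=
  ∀ n : ℤ, 0 ≤ n → a n vac = 0

theorem Creates.hasseZ {a : Dist (Module.End R V)} (h : Creates vac a) (m : ℕ) :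
    Creates vac (hasseZ m a) := by
  intro n hn
  simp only [LieVertex.hasseZ, LinearMap.smul_apply]
  by_cases hnm : (m : ℤ) ≤ n
  · rw [h _ (by omega), smul_zero]
  -- Here `0 ≤ n < m`, so the upper entry `m - n - 1` of the binomial coefficient is a natural
  -- number below `m` and the coefficient is zero.
  · obtain ⟨j, hj⟩ := Int.eq_ofNat_of_zero_le (show 0 ≤ (m : ℤ) - n - 1 by omega)
    rw [hj, Ring.choose_natCast, Nat.choose_eq_zero_of_lt (by omega), Nat.cast_zero, zero_smul]

theorem Creates.mulSub_bracket₂ {a b : Dist (Module.End R V)} (ha : Creates vac a)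
    (hb : Creates vac b) (k : ℕ) {m p : ℤ} (hm : 0 ≤ m) (hp : 0 ≤ p) :
    mulSub^[k] (bracket₂ a b) m p vac = 0 := by
  induction k generalizing m p with
  | zero => simp [bracket₂, LieRing.of_associative_ring_bracket, ha m hm, hb p hp]
  | succ k ih =>
    rw [mulSub_iterate_succ, LinearMap.sub_apply, ih (by omega) hp, ih hm (by omega), sub_zero]

/-- Each factor `z - w` raises one of the indices; raising that of `b` from `-1` to `0` gives zero
on the vacuum, so all `k` factors must go to `a`. -/
theorem Creates.mulSub_bracket₂_neg_one {a b : Dist (Module.End R V)} (ha : Creates vac a)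
    (hb : Creates vac b) (k : ℕ) {m : ℤ} (hm : 0 ≤ m) :
    mulSub^[k] (bracket₂ a b) m (-1) vac = a (m + k) (b (-1) vac) := by
  induction k generalizing m with
  | zero => simp [bracket₂, LieRing.of_associative_ring_bracket, ha m hm]
  | succ k ih =>
    rw [mulSub_iterate_succ, LinearMap.sub_apply, ih (by omega),
      show (-1 : ℤ) + 1 = 0 by rfl, ha.mulSub_bracket₂ hb k hm le_rfl, sub_zero]
    rw [show m + 1 + (k : ℤ) = m + ((k + 1 : ℕ) : ℤ) by push_cast; ring]

theorem Creates.normalProd {a b : Fields R V} (ha : Creates vac a.1) (hb : Creates vac b.1) :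
    Creates vac (normalProd a b).1 := by
  intro p hp
  change (∑ᶠ k : ℕ, a.1 (-(k : ℤ) - 1) (b.1 (p + k) vac)) +
    (∑ᶠ k : ℕ, b.1 (p - 1 - k) (a.1 k vac)) = 0
  have h1 : ∀ k : ℕ, a.1 (-(k : ℤ) - 1) (b.1 (p + k) vac) = 0 := fun k => by
    rw [hb _ (by omega), map_zero]
  have h2 : ∀ k : ℕ, b.1 (p - 1 - k) (a.1 k vac) = 0 := fun k => by
    rw [ha _ (by omega), map_zero]
  simp [h1, h2]

theorem Creates.normalProd_neg_one {a b : Fields R V} (ha : Creates vac a.1)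
    (hb : Creates vac b.1) : (LieVertex.normalProd a b).1 (-1) vac = a.1 (-1) (b.1 (-1) vac) := by
  change (∑ᶠ k : ℕ, a.1 (-(k : ℤ) - 1) (b.1 (-1 + k) vac)) +
    (∑ᶠ k : ℕ, b.1 (-1 - 1 - k) (a.1 k vac)) = _
  have h2 : ∀ k : ℕ, b.1 (-1 - 1 - k) (a.1 k vac) = 0 := fun k => by
    rw [ha _ (by omega), map_zero]
  rw [finsum_congr h2, finsum_zero, add_zero, finsum_eq_single _ 0]
  · simp
  · intro k hk
    rw [hb _ (by omega), map_zero]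

theorem Creates.nthProd {a b : Fields R V} (ha : Creates vac a.1) (hb : Creates vac b.1) (n : ℤ) :
    Creates vac (nthProd n a b).1 := by
  cases n with
  | ofNat n => exact fun p hp => ha.mulSub_bracket₂ hb n le_rfl hp
  | negSucc m => exact Creates.normalProd (a := hasseField m a) (ha.hasseZ m) hb

/-- The field-state map turns the `n`-th product with `a` into the operator `a_(n)`; for negative
`n`, `∂^{(m)} a` has `a_(-m-1)` as its coefficient of index `-1`, with binomial factor `1`. -/
theorem Creates.nthProd_neg_one {a b : Fields R V} (ha : Creates vac a.1) (hb : Creates vac b.1)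
    (n : ℤ) : (LieVertex.nthProd n a b).1 (-1) vac = a.1 n (b.1 (-1) vac) := by
  cases n with
  | ofNat n => exact (ha.mulSub_bracket₂_neg_one hb n le_rfl).trans (by rw [zero_add]; rfl)
  | negSucc m =>
    refine (Creates.normalProd_neg_one (a := hasseField m a) (ha.hasseZ m) hb).trans ?_
    have h : (hasseField m a).1 (-1) = a.1 (Int.negSucc m) := by
      simp only [hasseField, LieVertex.hasseZ]
      rw [show (m : ℤ) - -1 - 1 = m by ring, Ring.choose_natCast, Nat.choose_self, Nat.cast_one,
        one_smul, Int.negSucc_eq]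
      exact congrArg a.1 (by ring)
    rw [h]

theorem creates_idField : Creates vac (idField R V).1 := by
  intro n hn
  simp only [idField]
  rw [Pi.single_eq_of_ne (by omega)]
  rfl

theorem idField_neg_one : (idField R V).1 (-1) vac = vac := by
  simp [idField]

variable (vac) in
/-- The fields `φ` with `φ(z) vac ∈ V[[z]]`. -/
def creatingFields : Submodule R (Fields R V) where
  carrier := {φ | Creates vac φ.1}
  zero_mem' n _ := by simp
  add_mem' {a b} ha hb n hn := by simp [ha n hn, hb n hn]
  smul_mem' r a ha n hn := by simp [ha n hn]

theorem creates_of_mem_generatedFields {F : Set (Fields R V)} (hF : ∀ a ∈ F, Creates vac a.1)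
    {a : Fields R V} (ha : a ∈ generatedFields F) : Creates vac a.1 :=
  generatedFields_le (S := creatingFields vac) hF creates_idField
    (fun n _ _ ha hb => Creates.nthProd ha hb n) ha

/-- The states of the generated fields are stable under the coefficients of the generators. -/
theorem apply_mem_map_fieldState {F : Set (Fields R V)} (hF : ∀ a ∈ F, Creates vac a.1)
    {a : Fields R V} (ha : a ∈ F) (n : ℤ) {v : V}
    (hv : v ∈ (generatedFields F).map (fieldState vac)) :
    a.1 n v ∈ (generatedFields F).map (fieldState vac) := by
  obtain ⟨φ, hφ, rfl⟩ := hv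
  exact ⟨nthProd n a φ, nthProd_mem_generatedFields n (subset_generatedFields F ha) hφ,
    Creates.nthProd_neg_one (hF a ha) (creates_of_mem_generatedFields hF hφ) n⟩

end Vacuum

end Fields

/-! ### Generators of the universal enveloping algebra -/

/-- By the universal property, `ι` lifts to a map into `A` whose composite with the inclusion is the
identity. -/
theorem subalgebra_eq_top_of_ι_mem {R g : Type*} [CommRing R] [LieRing g]
    [LieAlgebra R g] (A : Subalgebra R (UniversalEnvelopingAlgebra R g))
    (h : ∀ x : g, UniversalEnvelopingAlgebra.ι R x ∈ A) : A = ⊤ := by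
  let f : g →ₗ⁅R⁆ A :=
    { toFun := fun x => ⟨UniversalEnvelopingAlgebra.ι R x, h x⟩
      map_add' := fun x y => Subtype.ext (map_add _ x y)
      map_smul' := fun r x => Subtype.ext (map_smul _ r x)
      map_lie' := fun {x y} => Subtype.ext (by
        simp [LieRing.of_associative_ring_bracket]) }
  have hf : A.val.comp (UniversalEnvelopingAlgebra.lift R f) = AlgHom.id R _ := by
    apply UniversalEnvelopingAlgebra.hom_ext
    ext x
    simp [f]
  rw [eq_top_iff]
  intro u _
  have hu : A.val (UniversalEnvelopingAlgebra.lift R f u) = u := DFunLike.congr_fun hf u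
  rw [← hu]
  exact (UniversalEnvelopingAlgebra.lift R f u).2

/-- Induction on `N`. Where `(z - w) f` vanishes, `f` is constant along `m + n`, so it can be moved
to the row `m = 0`, where vanishing is assumed. The bound involves only `m + n`, so it also gives
vanishing for fixed `n` and large `m`. -/
theorem eq_zero_of_mulSub_iterate_eq_zero {M : Type*} [AddCommGroup M] (N : ℕ) {f : Dist₂ M}
    (h : mulSub^[N] f = 0) (h0 : ∀ k : ℕ, ∀ᶠ n : ℤ in atTop, mulSub^[k] f 0 n = 0) :
    ∃ B : ℤ, ∀ (m : ℕ) (n : ℤ), B ≤ m + n → f m n = 0 := by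
  induction N generalizing f with
  | zero =>
    refine ⟨0, fun m n _ => ?_⟩
    rw [show f = 0 from h]
    rfl
  | succ N ih =>
    obtain ⟨B, hB⟩ := ih (f := mulSub f) h fun k => h0 (k + 1)
    obtain ⟨B', hB'⟩ := eventually_atTop.1 (h0 0)
    -- The relation between `f (m + 1) n` and `f m (n + 1)` sits at `(m, n)`, whose index sum is one
    -- less; hence `B + 1`.
    refine ⟨max (B + 1) B', fun m => ?_⟩
    induction m with
    | zero => exact fun n hn => hB' n (by push_cast at hn; omega)
    | succ m ihm =>
      intro n hn
      have h1 : f (m + 1) n - f m (n + 1) = 0 := hB m n (by push_cast at hn; omega)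
      rw [ihm (n + 1) (by push_cast at hn; omega), sub_zero] at h1
      exact_mod_cast h1

section LieAlgebra

variable {R : Type*} [CommRing R] {g : Type*} [LieRing g] [LieAlgebra R g] {J : Type*}
  {F : J → Dist g}

/-! ### The module `V` -/

theorem toState_mul (u w : UniversalEnvelopingAlgebra R g) :
    toState R F (u * w) = u • toState R F w :=
  (toState R F).map_smul u w

theorem toState_surjective : Function.Surjective (toState R F) :=
  Submodule.mkQ_surjective _

theorem toState_eq_zero {u : UniversalEnvelopingAlgebra R g} :
    toState R F u = 0 ↔ u ∈ saturation R (annihilationIdeal R F) :=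
  Submodule.Quotient.mk_eq_zero _

theorem le_saturation {A M : Type*} [Ring A] [Algebra R A] [AddCommGroup M] [Module R M]
    [Module A M] [IsScalarTower R A M] (N : Submodule A M) : N ≤ saturation R N :=
  fun x hx => ⟨1, one_mem _, by rwa [one_smul]⟩

theorem mem_saturation_of_smul_mem {A M : Type*} [Ring A] [Algebra R A] [AddCommGroup M]
    [Module R M] [Module A M] [IsScalarTower R A M] {N : Submodule A M} {r : R}
    (hr : r ∈ nonZeroDivisors R) {x : M} (hx : r • x ∈ saturation R N) : x ∈ saturation R N := by
  obtain ⟨s, hs, h⟩ := hx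
  exact ⟨s * r, mul_mem hs hr, by rwa [mul_smul]⟩

theorem stateSpace_smul_eq_zero {r : R} (hr : r ∈ nonZeroDivisors R) {v : StateSpace R F}
    (h : r • v = 0) : v = 0 := by
  obtain ⟨u, rfl⟩ := toState_surjective v
  have h1 : toState R F (r • u) = 0 := h
  exact toState_eq_zero.2 (mem_saturation_of_smul_mem hr (toState_eq_zero.1 h1))

theorem isTorsionFree_stateSpace : Module.IsTorsionFree R (StateSpace R F) where
  isSMulRegular r hr v w h := by
    have h1 : r • (v - w) = 0 := by
      rw [smul_sub, sub_eq_zero]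
      exact h
    exact sub_eq_zero.1 (stateSpace_smul_eq_zero hr.mem_nonZeroDivisors h1)

theorem isAddTorsionFree_stateSpace [IsAddTorsionFree R] : IsAddTorsionFree (StateSpace R F) where
  nsmul_right_injective n hn v w h := by
    -- Torsion freeness of `R` turns multiplication by `n` into multiplication by a
    -- non-zero-divisor.
    have hr : (n : R) ∈ nonZeroDivisors R := by
      refine mem_nonZeroDivisors_iff_right.2 fun x hx => ?_
      have hx' : n • x = n • (0 : R) := by rw [nsmul_eq_mul, mul_comm, hx, smul_zero]
      exact nsmul_right_injective hn hx'
    have h1 : (n : R) • (v - w) = 0 := by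
      rw [Nat.cast_smul_eq_nsmul, smul_sub, sub_eq_zero]
      exact h
    exact sub_eq_zero.1 (stateSpace_smul_eq_zero hr h1)

theorem actionDist_apply (a : Dist g) (n : ℤ) (v : StateSpace R F) :
    actionDist R F a n v = UniversalEnvelopingAlgebra.ι R (a n) • v := rfl

theorem ι_smul_toState_one (j : J) {n : ℤ} (hn : 0 ≤ n) :
    UniversalEnvelopingAlgebra.ι R (F j n) • toState R F 1 = 0 := by
  rw [← toState_mul, mul_one, toState_eq_zero]
  exact le_saturation _ (Submodule.subset_span
    ⟨F j n, Submodule.subset_span ⟨j, n, hn, rfl⟩, rfl⟩)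

/-- A saturated submodule that is stable under all `a^j_(n)` and contains the vacuum is all of
`V`. -/
theorem eq_top_of_stable (hL1 : saturation R (coeffSpan R F) = ⊤)
    {N : Submodule R (StateSpace R F)}
    (hsat : ∀ r ∈ nonZeroDivisors R, ∀ v, r • v ∈ N → v ∈ N)
    (hstable : ∀ j n, ∀ v ∈ N, UniversalEnvelopingAlgebra.ι R (F j n) • v ∈ N)
    (hone : toState R F 1 ∈ N) : N = ⊤ := by
  -- The stabilizer of `N` in `U(g)`; (L.1) and saturatedness of `N` put all of `g` into it.
  let A : Subalgebra R (UniversalEnvelopingAlgebra R g) :=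
    { carrier := {u | ∀ v ∈ N, u • v ∈ N}
      mul_mem' := fun {a b} ha hb v hv => by
        rw [mul_smul]
        exact ha _ (hb v hv)
      add_mem' := fun {a b} ha hb v hv => by
        rw [add_smul]
        exact N.add_mem (ha v hv) (hb v hv)
      algebraMap_mem' := fun r v hv => by
        rw [algebraMap_smul]
        exact N.smul_mem r hv }
  have hspan : ∀ x ∈ coeffSpan R F, UniversalEnvelopingAlgebra.ι R x ∈ A := by
    intro x hx
    refine Submodule.span_le (p := (Subalgebra.toSubmodule A).comap
      (UniversalEnvelopingAlgebra.ι R (L := g)).toLinearMap).2 ?_ hx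
    rintro _ ⟨j, n, rfl⟩
    exact hstable j n
  have hA : A = ⊤ := by
    refine subalgebra_eq_top_of_ι_mem A fun x v hv => ?_
    obtain ⟨r, hr, hx⟩ : x ∈ saturation R (coeffSpan R F) := by
      rw [hL1]
      trivial
    refine hsat r hr _ ?_
    have h1 := hspan _ hx v hv
    rwa [map_smul, smul_assoc] at h1
  rw [eq_top_iff]
  intro v _
  obtain ⟨u, rfl⟩ := toState_surjective v
  have hu : u ∈ A := by
    rw [hA]
    trivial
  rw [← mul_one u, toState_mul]
  exact hu _ hone

/-! ### The distributions `a^j(z)` act by fields -/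

theorem translationSpan_le {T : LieDerivation R g g} {S : Submodule R (Dist g)}
    (hF : ∀ j, F j ∈ S) (hT : ∀ a ∈ S, (fun n => T (a n)) ∈ S) : translationSpan T F ≤ S :=
  sInf_le ⟨by rintro _ ⟨j, rfl⟩; exact hF j, hT⟩

/-- On `F_T` the derivation `T` acts as `∂_z`, which only shifts and rescales coefficients. This
covariance is carried along in `S`, since without it `S` would not visibly be `T`-invariant. -/
theorem eventually_smul_eq_zero_of_mem_translationSpan {T : LieDerivation R g g}
    (hL2 : ∀ (j : J) (n : ℤ), T (F j n) = derivZ (F j) n) {v : StateSpace R F}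
    (hv : ∀ j, ∀ᶠ n : ℤ in atTop, UniversalEnvelopingAlgebra.ι R (F j n) • v = 0)
    {c : Dist g} (hc : c ∈ translationSpan T F) :
    ∀ᶠ n : ℤ in atTop, UniversalEnvelopingAlgebra.ι R (c n) • v = 0 := by
  let S : Submodule R (Dist g) :=
    { carrier := {c | (∀ n, T (c n) = (-n) • c (n - 1)) ∧
        ∀ᶠ n : ℤ in atTop, UniversalEnvelopingAlgebra.ι R (c n) • v = 0}
      zero_mem' := ⟨fun n => by simp, by simp⟩
      add_mem' := by
        rintro a b ⟨ha, ha'⟩ ⟨hb, hb'⟩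
        refine ⟨fun n => by rw [Pi.add_apply, map_add, ha, hb, Pi.add_apply, smul_add], ?_⟩
        filter_upwards [ha', hb'] with n h1 h2
        rw [Pi.add_apply, map_add, add_smul, h1, h2, add_zero]
      smul_mem' := by
        rintro r a ⟨ha, ha'⟩
        refine ⟨fun n => by rw [Pi.smul_apply, map_smul, ha, Pi.smul_apply, smul_comm], ?_⟩
        filter_upwards [ha'] with n h1
        rw [Pi.smul_apply, map_smul, smul_assoc, h1, smul_zero] }
  refine (translationSpan_le (S := S) (fun j => ⟨hL2 j, hv j⟩) ?_ hc).2
  rintro a ⟨ha, ha'⟩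
  refine ⟨fun n => by simp only [ha n, map_zsmul], ?_⟩
  filter_upwards [(tendsto_atTop_add_const_right atTop (-1 : ℤ) tendsto_id).eventually ha']
    with n hn
  rw [ha n, map_zsmul, smul_assoc, sub_eq_add_neg]
  exact (congrArg _ hn).trans (smul_zero _)

theorem actionDist_mem_fields {T : LieDerivation R g g}
    (hlocal : ∀ i j, MutuallyLocal (F i) (F j)) (hL1 : saturation R (coeffSpan R F) = ⊤)
    (hL2 : ∀ (j : J) (n : ℤ), T (F j n) = derivZ (F j) n)
    (hL3 : ∀ (n : ℕ) (i j : J), natProd n (F i) (F j) ∈ translationSpan T F) (j : J) :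
    actionDist R F (F j) ∈ Fields R (StateSpace R F) := by
  let N : Submodule R (StateSpace R F) :=
    { carrier := {v | ∀ j, ∀ᶠ n : ℤ in atTop, UniversalEnvelopingAlgebra.ι R (F j n) • v = 0}
      zero_mem' := fun j => by simp
      add_mem' := fun {v w} hv hw j => by
        filter_upwards [hv j, hw j] with n h1 h2
        rw [smul_add, h1, h2, add_zero]
      smul_mem' := fun r v hv j => by
        filter_upwards [hv j] with n h1
        rw [smul_algebra_smul_comm, h1, smul_zero] }
  suffices hN : N = ⊤ by
    intro v
    have hv : v ∈ N := by
      rw [hN]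
      trivial
    exact hv j
  refine eq_top_of_stable hL1 ?_ ?_ ?_
  · intro r hr v hv j
    filter_upwards [hv j] with n h1
    rw [smul_algebra_smul_comm] at h1
    exact stateSpace_smul_eq_zero hr h1
  · intro j m v hv i
    let φ : g →+ StateSpace R F :=
      AddMonoidHom.mk' (fun x => UniversalEnvelopingAlgebra.ι R x • v) fun x y => by
        rw [map_add, add_smul]
    have hφ : ∀ k, mulSub^[k] (fun m n => φ (bracket₂ (F i) (F j) m n)) =
        fun m n => φ (mulSub^[k] (bracket₂ (F i) (F j)) m n) := fun k => by
      funext m n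
      exact mulSub_iterate_map φ k _ m n
    -- It suffices to bound `[a^i_(n), a^j_(m)] v` for large `n`. Locality bounds the power of `z -
    -- w`, and (L.3) controls the residues of `(z - w)^k [a^i(z), a^j(w)] v`.
    obtain ⟨K, hK⟩ := mutuallyLocal_iff.1 (hlocal i j)
    obtain ⟨B, hB⟩ := eq_zero_of_mulSub_iterate_eq_zero K
      (f := fun m n => φ (bracket₂ (F i) (F j) m n))
      (by
        rw [hφ, hK]
        funext m n
        exact map_zero φ)
      (fun k => by
        rw [hφ]
        exact eventually_smul_eq_zero_of_mem_translationSpan hL2 hv (hL3 k i j))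
    filter_upwards [hv i, eventually_ge_atTop (B - m), eventually_ge_atTop 0] with n h1 h2 h3
    obtain ⟨n, rfl⟩ := Int.eq_ofNat_of_zero_le h3
    have h4 : UniversalEnvelopingAlgebra.ι R ⁅F i n, F j m⁆ • v = 0 := hB n m (by omega)
    rw [LieHom.map_lie, LieRing.of_associative_ring_bracket, sub_smul, mul_smul, mul_smul, h1,
      smul_zero, sub_zero] at h4
    exact h4
  · intro j
    filter_upwards [eventually_ge_atTop 0] with n hn
    exact ι_smul_toState_one j hn

theorem mutuallyLocal_actionDist {a b : Dist g} (h : MutuallyLocal a b) :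
    MutuallyLocal (actionDist R F a) (actionDist R F b) := by
  refine h.map (L' := Module.End R (StateSpace R F))
    (AddMonoidHom.mk' (fun x => Algebra.lsmul R R (StateSpace R F)
      (UniversalEnvelopingAlgebra.ι R x)) fun x y => by rw [map_add, map_add]) fun x y => ?_
  simp only [AddMonoidHom.mk'_apply]
  rw [LieHom.map_lie, LieRing.of_associative_ring_bracket, LieRing.of_associative_ring_bracket,
    map_sub, map_mul, map_mul]

/-! ### The translation operator -/

section Translation

variable {T : LieDerivation R g g}

theorem apply_mem_annihilation (hL2 : ∀ (j : J) (n : ℤ), T (F j n) = derivZ (F j) n) {x : g}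
    (hx : x ∈ annihilation R F) : T x ∈ annihilation R F := by
  refine Submodule.span_le (p := (annihilation R F).comap (T : g →ₗ[R] g)).2 ?_ hx
  rintro _ ⟨j, n, hn, rfl⟩
  change T (F j n) ∈ annihilation R F
  rw [hL2]
  -- The index would leave the range `n ≥ 0` only at `n = 0`, where the factor `-n` vanishes.
  rcases hn.eq_or_lt with rfl | hn
  · simp [derivZ]
  · have h : F j (n - 1) ∈ annihilation R F :=
      Submodule.subset_span ⟨j, n - 1, by omega, rfl⟩
    exact zsmul_mem h _

theorem envDerivation_mem_annihilationIdeal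
    (hL2 : ∀ (j : J) (n : ℤ), T (F j n) = derivZ (F j) n) {u : UniversalEnvelopingAlgebra R g}
    (hu : u ∈ annihilationIdeal R F) : envDerivation T u ∈ annihilationIdeal R F := by
  induction hu using Submodule.span_induction with
  | mem u hu =>
    obtain ⟨x, hx, rfl⟩ := hu
    rw [envDerivation_ι]
    exact Submodule.subset_span ⟨T x, apply_mem_annihilation hL2 hx, rfl⟩
  | zero =>
    rw [map_zero]
    exact Submodule.zero_mem _
  | add u w _ _ hu hw =>
    rw [map_add]
    exact Submodule.add_mem _ hu hw
  | smul a u hu' hu =>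
    rw [smul_eq_mul, envDerivation_mul]
    exact Submodule.add_mem _ (Submodule.smul_mem _ a hu) (Submodule.smul_mem _ _ hu')

theorem envDerivation_mem_saturation
    (hL2 : ∀ (j : J) (n : ℤ), T (F j n) = derivZ (F j) n) {u : UniversalEnvelopingAlgebra R g}
    (hu : u ∈ saturation R (annihilationIdeal R F)) :
    envDerivation T u ∈ saturation R (annihilationIdeal R F) := by
  obtain ⟨r, hr, h⟩ := hu
  refine ⟨r, hr, ?_⟩
  rw [← map_smul]
  exact envDerivation_mem_annihilationIdeal hL2 h

/-- The endomorphism of `V` induced by the derivation of `U(g)` that extends `T`. -/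
def stateTranslation (hL2 : ∀ (j : J) (n : ℤ), T (F j n) = derivZ (F j) n) :
    Module.End R (StateSpace R F) :=
  -- The derivation is only `R`-linear, so it is induced on the quotient of `R`-modules.
  let e := Submodule.Quotient.restrictScalarsEquiv R (saturation R (annihilationIdeal R F))
  e.toLinearMap ∘ₗ Submodule.mapQ _ _ (envDerivation T)
    (fun _ hu => envDerivation_mem_saturation hL2 hu) ∘ₗ e.symm.toLinearMap

theorem stateTranslation_toState (hL2 : ∀ (j : J) (n : ℤ), T (F j n) = derivZ (F j) n)
    (u : UniversalEnvelopingAlgebra R g) :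
    stateTranslation hL2 (toState R F u) = toState R F (envDerivation T u) := rfl

theorem envDerivation_one : envDerivation T 1 = 0 := by
  have h := envDerivation_mul T 1 1
  simpa using h

theorem translationCovariant_actionDist (hL2 : ∀ (j : J) (n : ℤ), T (F j n) = derivZ (F j) n)
    (j : J) : TranslationCovariant (stateTranslation hL2) (actionDist R F (F j)) := by
  refine fun n => LinearMap.ext fun v => ?_
  obtain ⟨u, rfl⟩ := toState_surjective v
  simp only [LinearMap.sub_apply, Module.End.mul_apply, actionDist_apply, derivZ,
    LinearMap.smul_apply, stateTranslation_toState]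
  rw [← toState_mul, ← toState_mul, ← toState_mul, stateTranslation_toState, envDerivation_mul,
    envDerivation_ι, hL2, derivZ, map_add, add_sub_cancel_left, map_zsmul, smul_mul_assoc,
    map_zsmul]

end Translation

end LieAlgebra

end LieVertex

end

-- The vertex algebra structure on `V`

theorem mainTheorem10 {R : Type*} [CommRing R] [IsAddTorsionFree R]
    {g : Type*} [LieRing g] [LieAlgebra R g] [Module.IsTorsionFree R g]
    (T : LieDerivation R g g) {J : Type*} (F : J → LieVertex.Dist g)
    (hlocal : ∀ i j, LieVertex.MutuallyLocal (F i) (F j))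
    (hL1 : LieVertex.saturation R (LieVertex.coeffSpan R F) = ⊤)
    (hL2 : ∀ (j : J) (n : ℤ), T (F j n) = LieVertex.derivZ (F j) n)
    (hL3 : ∀ (n : ℕ) (i j : J),
      LieVertex.natProd n (F i) (F j) ∈ LieVertex.translationSpan T F) :
    ∃ hfield : ∀ j, LieVertex.actionDist R F (F j) ∈
        LieVertex.Fields R (LieVertex.StateSpace R F),
      ∃ A : LieVertex.VertexAlgebra R (LieVertex.StateSpace R F),
        A.vacuum = LieVertex.toState R F 1 ∧
        (∀ u : UniversalEnvelopingAlgebra R g,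
          A.T (LieVertex.toState R F u) =
            LieVertex.toState R F (LieVertex.envDerivation T u)) ∧
        A.Fld = LieVertex.generatedFields
          (Set.range fun j => ⟨LieVertex.actionDist R F (F j), hfield j⟩) := by
  have hfield := LieVertex.actionDist_mem_fields hlocal hL1 hL2 hL3
  have htf : IsAddTorsionFree (LieVertex.StateSpace R F) := LieVertex.isAddTorsionFree_stateSpace
  let S : Set (LieVertex.Fields R (LieVertex.StateSpace R F)) :=
    Set.range fun j => ⟨LieVertex.actionDist R F (F j), hfield j⟩
  have hS : ∀ a ∈ S, LieVertex.Creates (LieVertex.toState R F 1) a.1 := by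
    rintro _ ⟨j, rfl⟩ n hn
    exact LieVertex.ι_smul_toState_one j hn
  refine ⟨hfield, {
    torsionFree := LieVertex.isTorsionFree_stateSpace
    addTorsionFree := htf
    vacuum := LieVertex.toState R F 1
    T := LieVertex.stateTranslation hL2
    T_vacuum := ?_
    Fld := LieVertex.generatedFields S
    id_mem := LieVertex.idField_mem_generatedFields S
    vacuum_axiom := fun φ hφ => LieVertex.creates_of_mem_generatedFields hS hφ
    translation := fun φ hφ => LieVertex.translationCovariant_of_mem_generatedFields ?_ hφ
    locality := fun φ hφ ψ hψ => LieVertex.mutuallyLocal_of_mem_generatedFields ?_ hφ hψ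
    nthProd_mem := fun n φ hφ ψ hψ => LieVertex.nthProd_mem_generatedFields n hφ hψ
    completeness := ?_ }, rfl, LieVertex.stateTranslation_toState hL2, rfl⟩
  · rw [LieVertex.stateTranslation_toState, LieVertex.envDerivation_one, map_zero]
  · rintro _ ⟨j, rfl⟩
    exact LieVertex.translationCovariant_actionDist hL2 j
  · rintro _ ⟨i, rfl⟩ _ ⟨j, rfl⟩
    exact LieVertex.mutuallyLocal_actionDist (hlocal i j)
  -- Completeness: the saturated space of states contains the vacuum, as the state of `I_V`, and is
  -- stable under the `a^j_(n)` because `a_(n)` of a state is the state of an `n`-th product.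
  · refine LieVertex.eq_top_of_stable hL1
      (N := LieVertex.saturation R ((LieVertex.generatedFields S).map
        (LieVertex.fieldState (LieVertex.toState R F 1))))
      (fun r hr v hv => LieVertex.mem_saturation_of_smul_mem hr hv) ?_
      (LieVertex.le_saturation _ ⟨LieVertex.idField R (LieVertex.StateSpace R F),
        LieVertex.idField_mem_generatedFields S, LieVertex.idField_neg_one (R := R)⟩)
    rintro j n v ⟨r, hr, hv⟩
    refine ⟨r, hr, ?_⟩
    rw [← smul_algebra_smul_comm]
    exact LieVertex.apply_mem_map_fieldState hS ⟨j, rfl⟩ n hv
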